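/- Let $X\subseteq\{1,\dots,k\}^{\mathbb N}$ be a one-sided subshift (closed, $\sigma(X)\subseteq X$) with language $B(X)$ having the weak specification property: there is $p$ such that for all $u,v\in B(X)$ there is $w\in B(X)$ of length at most $p$ with $uwv\in B(X)$. Let $M(X,\sigma)$ be the set of $\sigma$-invariant Borel probability measures on $X$, let $[x_1\dots x_n]$ denote cylinder sets in $X$, and let $h_m$ denote the Kolmogorov–Sinai entropy. Let $\mathcal F=\{\log f_n\}_{n\ge1}$ with $f_n:X\to(0,\infty)$ continuous. $\mathcal F$ is *weakly almost additive* if there are $C_n>0$ with $C_n/n\to0$ such that $e^{-C_n}f_n(x)f_m(\sigma^n x)\le f_{n+m}(x)\le e^{C_n}f_n(x)f_m(\sigma^n x)$ for all $x\in X$ and $n,m\ge1$, and *almost additive* if $C_n=C$ can be taken constant. A measure $\mu\in M(X,\sigma)$ is an (invariant) *weak Gibbs measure* for $\mathcal F$ if there are $P\in\mathbb R$ and $C_n>0$ with $\frac1n\log C_n\to0$ such that $C_n^{-1}\le \mu[x_1\dots x_n]/(e^{-nP}f_n(x))\le C_n$ for all $x\in X$, $n\ge1$, and a *Gibbs measure*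 if $C_n=C$ can be taken constant. It is an *equilibrium state* for $\mathcal F$ if $\lim_n\frac1n\int\log f_n\,dm$ exists for all $m\in M(X,\sigma)$ and $h_m+\lim_n\frac1n\int\log f_n\,dm$ attains its supremum over $m\in M(X,\sigma)$ at $m=\mu$. For a bounded Borel function $g$ on $X$ the (weak) Gibbs measures are defined with $f_n=e^{S_ng}$, $S_ng=\sum_{i<n}g\circ\sigma^i$, and an equilibrium state is a measure in $M(X,\sigma)$ at which $h_m+\int g\,dm$ attains its supremum over $m\in M(X,\sigma)$. Suppose $\nu\in M(X,\sigma)$ is a Gibbs measure for $\mathcal F$ with constants $P\in\mathbb R$ and $C_0>0$, and that for every $x\in X$ the lower and upper limits, in $[-\infty,\infty]$, of $\log\frac{\nu[x_1\dots x_n]}{\nu[x_2\dots x_n]}$ coincide. Put $r(x)=\lim_{n\to\infty}\log\frac{\nu[x_1\dots x_n]}{\nu[x_2\dots x_n]}+P$. (i) If $\mathcal F$ is almost additive, then $r$ is finite everywhere, bounded and Borel measurable, and for every $\mu\in M(X,\sigma)$ $$\lim_{n\to\infty}\frac1n\int\log f_n\,d\mu=\lim_{n\to\infty}\frac1n\int\log\big(\nu[x_1\dots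 x_n]e^{nP}\big)\,d\mu(x)=\int r\,d\mu .$$ Moreover, $\nu$ is the unique equilibrium state for $\mathcal F$, the unique equilibrium state for $r$, and the unique invariant Gibbs measure for $r$. (ii) If $\mathcal F$ is weakly almost additive, then $r$ is finite everywhere, bounded and Borel measurable, the displayed equalities hold for every $\mu\in M(X,\sigma)$, and $\nu$ is an equilibrium state for $r$ and an invariant weak Gibbs measure for $r$. -/

import Mathlib

open MeasureTheory Filter Topology Set
open SymbolicDynamics.FullShift (Subshift)

noncomputable section

namespace SymbGibbs

/-! ### Measure-theoretic (Kolmogorov-Sinai) entropy -/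

section Entropy

variable {Ω : Type*} [MeasurableSpace Ω]

/-- Shannon entropy `-∑ μ(A) log μ(A)` of the finite partition into the fibres of `α`. -/
def partitionEntropy {ι : Type*} [Fintype ι] (μ : Measure Ω) (α : Ω → ι) : ℝ :=
  ∑ a, Real.negMulLog (μ.real (α ⁻¹' {a}))

/-- The entropy of `T` with respect to the partition `α`, i.e. the limit of `H(α_n) / n`, where
`α_n` is the common refinement of `α, T⁻¹α, …, T⁻⁽ⁿ⁻¹⁾α`. The limit exists by subadditivity
whenever `μ` is a `T`-invariant probability measure, so taking the `limsup` is harmless. -/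
def entropyOfPartition {ι : Type*} [Fintype ι] (T : Ω → Ω) (μ : Measure Ω) (α : Ω → ι) : EReal :=
  limsup (fun n : ℕ =>
    ((partitionEntropy μ (fun x (i : Fin n) => α (T^[i] x)) / n : ℝ) : EReal)) atTop

/-- Kolmogorov-Sinai entropy `h_μ(T)`: the supremum over all finite measurable partitions. -/
def entropy (T : Ω → Ω) (μ : Measure Ω) : EReal :=
  ⨆ (m : ℕ) (α : Ω → Fin m) (_ : Measurable α), entropyOfPartition T μ α

end Entropy

/-! ### Subshifts over `k` symbols

`Subshift (Fin k) ℕ` is the type of closed shift-invariant subsets of `(Fin k)^ℕ`. Coordinates are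
numbered from `0`, so the letters `x₁, x₂, …` of a point are `x 0, x 1, …`. -/

variable {k : ℕ}

/-- The shift map of a subshift. -/
def sigma (X : Subshift (Fin k) ℕ) : X.carrier → X.carrier :=
  (X.mapsTo 1).restrict (SymbolicDynamics.FullShift.shift 1) X.carrier X.carrier

/-- The cylinder `[x₁ … xₙ]` in `X`. -/
def cyl (X : Subshift (Fin k) ℕ) (n : ℕ) (x : X.carrier) : Set X.carrier :=
  {z | ∀ i < n, z.1 i = x.1 i}

/-- The language of `X`: all finite words that appear in points of `X`. -/
def language (X : Subshift (Fin k) ℕ) : Set (List (Fin k)) :=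
  {w | ∃ x ∈ X.carrier, ∃ i : ℕ, ∀ (j : ℕ) (hj : j < w.length), w[j] = x (i + j)}

/-- The weak specification property. -/
def WeakSpecification (X : Subshift (Fin k) ℕ) : Prop :=
  ∃ p : ℕ, ∀ u ∈ language X, ∀ v ∈ language X,
    ∃ w ∈ language X, w.length ≤ p ∧ u ++ w ++ v ∈ language X

/-- The set of shift-invariant Borel probability measures on `X`. -/
def invMeasures (X : Subshift (Fin k) ℕ) : Set (Measure X.carrier) :=
  {μ | IsProbabilityMeasure μ ∧ MeasurePreserving (sigma X) μ μ}

/-! ### Sequences `{log f_n}`, `n ≥ 1`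

A sequence is given by the functions `f n : X → ℝ`; the value of `f 0` is never used. -/

/-- `f n : X → ℝ⁺` is continuous for every `n ≥ 1`. -/
def IsContSeq (X : Subshift (Fin k) ℕ) (f : ℕ → X.carrier → ℝ) : Prop :=
  ∀ n ≥ 1, Continuous (f n) ∧ ∀ x, 0 < f n x

/-- The two inequalities of almost additivity, with constants `C n`. -/
def AdditiveBounds (X : Subshift (Fin k) ℕ) (f : ℕ → X.carrier → ℝ) (C : ℕ → ℝ) : Prop :=
  ∀ n ≥ 1, ∀ m ≥ 1, ∀ x,
    f (n + m) x ≤ Real.exp (C n) * f n x * f m ((sigma X)^[n] x) ∧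
    Real.exp (-C n) * f n x * f m ((sigma X)^[n] x) ≤ f (n + m) x

/-- The sequence `{log f_n}` is almost additive. -/
def AlmostAdditive (X : Subshift (Fin k) ℕ) (f : ℕ → X.carrier → ℝ) : Prop :=
  ∃ C : ℝ, 0 < C ∧ AdditiveBounds X f (fun _ => C)

/-- The sequence `{log f_n}` is weakly almost additive. -/
def WeaklyAlmostAdditive (X : Subshift (Fin k) ℕ) (f : ℕ → X.carrier → ℝ) : Prop :=
  ∃ C : ℕ → ℝ, (∀ n ≥ 1, 0 < C n) ∧ Tendsto (fun n : ℕ => C n / n) atTop (𝓝 0) ∧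
    AdditiveBounds X f C

/-- `1 / C_n ≤ μ[x₁ … xₙ] / (e^{-nP} f_n(x)) ≤ C_n` for all `x` and all `n ≥ 1`. -/
def GibbsBounds (X : Subshift (Fin k) ℕ) (f : ℕ → X.carrier → ℝ) (μ : Measure X.carrier)
    (P : ℝ) (C : ℕ → ℝ) : Prop :=
  ∀ n ≥ 1, ∀ x,
    1 / C n ≤ μ.real (cyl X n x) / (Real.exp (-(n * P)) * f n x) ∧
    μ.real (cyl X n x) / (Real.exp (-(n * P)) * f n x) ≤ C n

/-- `μ` is an invariant Gibbs measure for `{log f_n}`. -/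
def IsGibbs (X : Subshift (Fin k) ℕ) (f : ℕ → X.carrier → ℝ) (μ : Measure X.carrier) : Prop :=
  μ ∈ invMeasures X ∧ ∃ P C : ℝ, 0 < C ∧ GibbsBounds X f μ P (fun _ => C)

/-- `μ` is an invariant weak Gibbs measure for `{log f_n}`. -/
def IsWeakGibbs (X : Subshift (Fin k) ℕ) (f : ℕ → X.carrier → ℝ) (μ : Measure X.carrier) : Prop :=
  μ ∈ invMeasures X ∧ ∃ (P : ℝ) (C : ℕ → ℝ), (∀ n ≥ 1, 0 < C n) ∧
    Tendsto (fun n : ℕ => Real.log (C n) / n) atTop (𝓝 0) ∧ GibbsBounds X f μ P C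

/-- `μ` is an equilibrium state for `{log f_n}`. Here `L m` is the limit of `(1/n) ∫ log f_n dm`;
that it exists for every invariant `m` is part of the definition. -/
def IsEquilibriumSeq (X : Subshift (Fin k) ℕ) (f : ℕ → X.carrier → ℝ)
    (μ : Measure X.carrier) : Prop :=
  μ ∈ invMeasures X ∧ ∃ L : Measure X.carrier → ℝ,
    (∀ m ∈ invMeasures X,
      Tendsto (fun n : ℕ => (1 / n : ℝ) * ∫ x, Real.log (f n x) ∂m) atTop (𝓝 (L m))) ∧
    entropy (sigma X) μ + (L μ : EReal) =
      ⨆ m ∈ invMeasures X, entropy (sigma X) m + (L m : EReal)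

/-! ### Single functions -/

/-- The sequence `e^{S_n g}` attached to a function `g`. -/
def expBirkhoff (X : Subshift (Fin k) ℕ) (g : X.carrier → ℝ) (n : ℕ) (x : X.carrier) : ℝ :=
  Real.exp (birkhoffSum (sigma X) g n x)

/-- `μ` is an equilibrium state for the (bounded Borel) function `g`. -/
def IsEquilibriumFun (X : Subshift (Fin k) ℕ) (g : X.carrier → ℝ)
    (μ : Measure X.carrier) : Prop :=
  μ ∈ invMeasures X ∧
    entropy (sigma X) μ + ((∫ x, g x ∂μ : ℝ) : EReal) =
      ⨆ m ∈ invMeasures X, entropy (sigma X) m + ((∫ x, g x ∂m : ℝ) : EReal)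

/-- `log (ν[x₁ … xₙ₊₁] / ν[x₂ … xₙ₊₁])`. -/
def logRatio (X : Subshift (Fin k) ℕ) (ν : Measure X.carrier) (n : ℕ) (x : X.carrier) : ℝ :=
  Real.log (ν.real (cyl X (n + 1) x) / ν.real (cyl X n (sigma X x)))

/-- `liminf log (ν[x₁ … xₙ] / ν[x₂ … xₙ]) + P`, in the extended reals. -/
def rLower (X : Subshift (Fin k) ℕ) (ν : Measure X.carrier) (P : ℝ) (x : X.carrier) : EReal :=
  liminf (fun n : ℕ => (logRatio X ν n x : EReal)) atTop + (P : EReal)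

/-- `limsup log (ν[x₁ … xₙ] / ν[x₂ … xₙ]) + P`, in the extended reals. -/
def rUpper (X : Subshift (Fin k) ℕ) (ν : Measure X.carrier) (P : ℝ) (x : X.carrier) : EReal :=
  limsup (fun n : ℕ => (logRatio X ν n x : EReal)) atTop + (P : EReal)

/-- `r` is the pointwise (finite) limit of `log (ν[x₁ … xₙ] / ν[x₂ … xₙ]) + P`. -/
def IsLimitPotential (X : Subshift (Fin k) ℕ) (ν : Measure X.carrier) (P : ℝ)
    (r : X.carrier → ℝ) : Prop :=
  ∀ x, Tendsto (fun n : ℕ => logRatio X ν n x + P) atTop (𝓝 (r x))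

/-- For every invariant `μ`, both `(1/n) ∫ log f_n dμ` and `(1/n) ∫ log (ν[x₁ … xₙ] e^{nP}) dμ`
converge to `∫ r dμ`. -/
def IntegralLimits (X : Subshift (Fin k) ℕ) (f : ℕ → X.carrier → ℝ) (ν : Measure X.carrier)
    (P : ℝ) (r : X.carrier → ℝ) : Prop :=
  ∀ μ ∈ invMeasures X,
    Tendsto (fun n : ℕ => (1 / n : ℝ) * ∫ x, Real.log (f n x) ∂μ) atTop (𝓝 (∫ x, r x ∂μ)) ∧
    Tendsto (fun n : ℕ => (1 / n : ℝ) *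
        ∫ x, Real.log (ν.real (cyl X n x) * Real.exp (n * P)) ∂μ) atTop (𝓝 (∫ x, r x ∂μ))

end SymbGibbs

end

noncomputable section

namespace SymbGibbs

/-! ### Shannon entropy of finite partitions. -/

section FiniteEntropy

variable {Ω : Type*} [MeasurableSpace Ω]

/-! The Gibbs property together with the additivity bound for splitting off one letter bounds the
log-ratios uniformly, so their limit `r` is finite, bounded and Borel. Integrated against an
invariant μ, a log-ratio becomes a difference of consecutive terms of a_n = ∫ log ν[x₁…xₙ] dμ.
Dominated convergence and Cesàro averaging give a_n/n → ∫ r dμ − P, and the Gibbs bounds transfer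
this to `log f n` (`IsLimitPotential.integralLimits`).

By the generator theorem (`exists_entropy_eq`), h_μ is both the limit and a lower bound of H_n(μ)/n,
where H_n is the entropy of the n-cylinder partition. Relative entropy of μ with respect to ν on
n-cylinders is nonnegative, that is H_n(μ) + a_n ≤ 0. Dividing by n yields h_μ + ∫ r dμ ≤ P, with
equality for μ = ν. So ν is an equilibrium state in both parts.

Telescoping shows that S_n r stays within C_n + 3 log C₀ of log ν[x₁…xₙ] + nP, so ν is weak Gibbs
for `r`, and Gibbs when C_n is constant. In the latter case the relative entropies of any
equilibrium state are bounded, which forces μ ≪ ν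
(`absolutelyContinuous_of_relativeEntropy_bounded`); another Gibbs measure for `r` is dominated by a
multiple of ν. Moreover ν is quasi-Bernoulli, and weak specification then makes it ergodic
(`ergodic_of_quasiBernoulli`), so an invariant probability μ ≪ ν equals ν. -/

theorem partitionEntropy_equiv {μ : Measure Ω} {ι κ : Type*} [Fintype ι] [Fintype κ] 
    (e : ι ≃ κ) (F : Ω → ι) :
    partitionEntropy μ (fun x => e (F x)) = partitionEntropy μ F := by
  rw [partitionEntropy, partitionEntropy, ← e.sum_comp]
  refine Finset.sum_congr rfl fun s _ => ?_
  congr 2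
  ext x
  simp

theorem partitionEntropy_comp {μ : Measure Ω} {ι : Type*} [Fintype ι] [MeasurableSpace ι]
    [MeasurableSingletonClass ι] {T : Ω → Ω} (hT : MeasurePreserving T μ μ) {F : Ω → ι}
    (hF : Measurable F) : partitionEntropy μ (fun x => F (T x)) = partitionEntropy μ F := by
  rw [partitionEntropy, partitionEntropy]
  refine Finset.sum_congr rfl fun s _ => ?_
  congr 1
  exact hT.measureReal_preimage (hF (measurableSet_singleton s)).nullMeasurableSet

theorem partitionEntropy_nonneg {μ : Measure Ω} [IsProbabilityMeasure μ] {ι : Type*} [Fintype ι]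
    (F : Ω → ι) : 0 ≤ partitionEntropy μ F :=
  Finset.sum_nonneg fun _ _ => Real.negMulLog_nonneg measureReal_nonneg measureReal_le_one

theorem bddBelow_partitionEntropy_div {μ : Measure Ω} [IsProbabilityMeasure μ] {ι : ℕ → Type*}
    [∀ n, Fintype (ι n)]
    (F : ∀ n, Ω → ι n) : BddBelow (range fun n : ℕ => partitionEntropy μ (F n) / n) := by
  refine ⟨0, ?_⟩
  rintro _ ⟨n, rfl⟩
  exact div_nonneg (partitionEntropy_nonneg _) n.cast_nonneg

theorem sum_measureReal_fiber_prodMk {μ : Measure Ω} [IsProbabilityMeasure μ]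
    {ι κ : Type*} [Fintype ι] [MeasurableSpace ι] [MeasurableSingletonClass ι]
    [MeasurableSpace κ] [MeasurableSingletonClass κ] {A : Ω → ι} (hA : Measurable A) {S : Ω → κ}
    (hS : Measurable S) (s : κ) :
    ∑ a, μ.real ((fun x => (A x, S x)) ⁻¹' {(a, s)}) = μ.real (S ⁻¹' {s}) := by
  rw [← measureReal_biUnion_finset]
  · congr 1
    ext x
    simp
  · intro a _ b _ hab
    refine Set.disjoint_left.2 fun x hx hx' => hab ?_
    simp only [mem_preimage, mem_singleton_iff, Prod.mk.injEq] at hx hx'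
    exact hx.1.symm.trans hx'.1
  · exact fun a _ => (hA.prodMk hS) (measurableSet_singleton _)

/-- The itinerary of length `n` of a point with respect to the partition `α`. -/
def itinerary {ι : Type*} (T : Ω → Ω) (α : Ω → ι) (n : ℕ) (x : Ω) : Fin n → ι :=
  fun i => α (T^[i] x)

theorem measurable_itinerary {ι : Type*} [MeasurableSpace ι] {T : Ω → Ω} (hT : Measurable T)
    {α : Ω → ι} (hα : Measurable α) (n : ℕ) : Measurable (itinerary T α n) :=
  measurable_pi_lambda _ fun i => hα.comp (hT.iterate i)

variable {μ : Measure Ω} [IsProbabilityMeasure μ]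
  {ι κ : Type*} [Fintype ι] [MeasurableSpace ι] [MeasurableSingletonClass ι]
  [Fintype κ] [MeasurableSpace κ] [MeasurableSingletonClass κ]

theorem integrable_comp_fintype {F : Ω → ι} (hF : Measurable F) (φ : ι → ℝ) :
    Integrable (fun x => φ (F x)) μ :=
  have := Measure.isProbabilityMeasure_map (μ := μ) hF.aemeasurable
  (Integrable.of_finite (μ := μ.map F) (f := φ)).comp_measurable hF

theorem integral_comp_fintype {F : Ω → ι} (hF : Measurable F) (φ : ι → ℝ) :
    ∫ x, φ (F x) ∂μ = ∑ s, μ.real (F ⁻¹' {s}) * φ s := by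
  have := Measure.isProbabilityMeasure_map (μ := μ) hF.aemeasurable
  have hi : Integrable φ (μ.map F) := Integrable.of_finite
  rw [← integral_map hF.aemeasurable hi.aestronglyMeasurable, integral_fintype hi]
  refine Finset.sum_congr rfl fun s _ => ?_
  rw [map_measureReal_apply hF (measurableSet_singleton s), smul_eq_mul]

theorem sum_measureReal_fiber {F : Ω → ι} (hF : Measurable F) :
    ∑ s, μ.real (F ⁻¹' {s}) = 1 := by
  simpa using (integral_comp_fintype (μ := μ) hF (fun _ => 1)).symm

/-- The entropy of a partition as the integral of its information function. -/
theorem partitionEntropy_eq_integral {F : Ω → ι} (hF : Measurable F) :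
    partitionEntropy μ F = ∫ x, -Real.log (μ.real (F ⁻¹' {F x})) ∂μ := by
  rw [integral_comp_fintype hF (fun s => -Real.log (μ.real (F ⁻¹' {s}))), partitionEntropy]
  exact Finset.sum_congr rfl fun s _ => by rw [Real.negMulLog]; ring

/-- Gibbs' inequality, for weights that need not be normalized. -/
theorem partitionEntropy_le_crossEntropy {F : Ω → ι} (hF : Measurable F) {q : ι → ℝ}
    (hq : ∀ s, 0 ≤ q s) (hpos : ∀ s, μ.real (F ⁻¹' {s}) ≠ 0 → 0 < q s) :
    partitionEntropy μ F ≤ ∫ x, -Real.log (q (F x)) ∂μ + (∑ s, q s - 1) := by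
  rw [integral_comp_fintype hF (fun s => -Real.log (q s)), ← sum_measureReal_fiber (μ := μ) hF,
    ← Finset.sum_sub_distrib, ← Finset.sum_add_distrib, partitionEntropy]
  refine Finset.sum_le_sum fun s _ => ?_
  rcases eq_or_ne (μ.real (F ⁻¹' {s})) 0 with h | h
  · simp [h, hq s]
  -- Use log t ≤ t − 1 at t = q s / p s and multiply by p s.
  · have hp : 0 < μ.real (F ⁻¹' {s}) := lt_of_le_of_ne measureReal_nonneg h.symm
    have h1 := Real.log_le_sub_one_of_pos (div_pos (hpos s h) hp)
    rw [Real.log_div (hpos s h).ne' h] at h1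
    have h2 := mul_le_mul_of_nonneg_left h1 hp.le
    rw [mul_sub, mul_sub, mul_div_cancel₀ _ h] at h2
    rw [Real.negMulLog]
    linarith

/-- Each fibre of the pair lies in a fibre of `S`, so its information −log is at least as large. -/
theorem partitionEntropy_le_prodMk {A : Ω → ι} (hA : Measurable A) {S : Ω → κ}
    (hS : Measurable S) :
    partitionEntropy μ S ≤ partitionEntropy μ (fun x => (A x, S x)) := by
  rw [partitionEntropy, partitionEntropy, Fintype.sum_prod_type_right]
  refine Finset.sum_le_sum fun s _ => ?_
  have hs := sum_measureReal_fiber_prodMk (μ := μ) hA hS s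
  rw [Real.negMulLog, neg_mul, ← mul_neg, ← hs, Finset.sum_mul, hs]
  refine Finset.sum_le_sum fun a _ => ?_
  rw [Real.negMulLog, neg_mul, ← mul_neg]
  rcases eq_or_ne (μ.real ((fun x => (A x, S x)) ⁻¹' {(a, s)})) 0 with h | h
  · simp [h]
  · have hp : 0 < μ.real ((fun x => (A x, S x)) ⁻¹' {(a, s)}) :=
      lt_of_le_of_ne measureReal_nonneg h.symm
    refine mul_le_mul_of_nonneg_left (neg_le_neg (Real.log_le_log hp ?_)) hp.le
    refine measureReal_mono fun x hx => ?_
    simp only [mem_preimage, mem_singleton_iff, Prod.mk.injEq] at hx ⊢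
    exact hx.2

/-- The conditional entropy of `A` given `S` is at most the expected code length of `A` for any
family of conditional weights `Q`. -/
theorem partitionEntropy_prodMk_le {A : Ω → ι} (hA : Measurable A) {S : Ω → κ}
    (hS : Measurable S) {Q : κ → ι → ℝ} (hQ : ∀ s a, 0 ≤ Q s a) (hQ1 : ∀ s, ∑ a, Q s a ≤ 1)
    (hpos : ∀ s a, μ.real (A ⁻¹' {a}) ≠ 0 → 0 < Q s a) :
    partitionEntropy μ (fun x => (A x, S x)) ≤
      partitionEntropy μ S + ∫ x, -Real.log (Q (S x) (A x)) ∂μ := by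
  have hAS := hA.prodMk hS
  have hp : ∀ as : ι × κ, μ.real ((fun x => (A x, S x)) ⁻¹' {as}) ≠ 0 →
      0 < μ.real (S ⁻¹' {as.2}) ∧ 0 < Q as.2 as.1 := by
    intro as h
    have h' := lt_of_le_of_ne measureReal_nonneg h.symm
    refine ⟨h'.trans_le (measureReal_mono fun x hx => ?_),
      hpos _ _ (h'.trans_le (measureReal_mono fun x hx => ?_)).ne'⟩
    · exact congrArg Prod.snd hx
    · exact congrArg Prod.fst hx
  have h1 := partitionEntropy_le_crossEntropy (μ := μ) hAS
    (q := fun as => μ.real (S ⁻¹' {as.2}) * Q as.2 as.1)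
    (fun as => mul_nonneg measureReal_nonneg (hQ _ _)) (fun as h => mul_pos (hp as h).1 (hp as h).2)
  have h2 : ∑ as : ι × κ, μ.real (S ⁻¹' {as.2}) * Q as.2 as.1 ≤ 1 := by
    rw [Fintype.sum_prod_type_right, ← sum_measureReal_fiber (μ := μ) hS]
    refine Finset.sum_le_sum fun s _ => ?_
    dsimp only
    rw [← Finset.mul_sum]
    exact mul_le_of_le_one_right measureReal_nonneg (hQ1 s)
  have h3 : ∫ x, -Real.log (μ.real (S ⁻¹' {S x}) * Q (S x) (A x)) ∂μ =
      partitionEntropy μ S + ∫ x, -Real.log (Q (S x) (A x)) ∂μ := by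
    rw [partitionEntropy_eq_integral hS, ← integral_add
      (integrable_comp_fintype hS (fun s => -Real.log (μ.real (S ⁻¹' {s}))))
      (integrable_comp_fintype hAS (fun as => -Real.log (Q as.2 as.1))),
      integral_comp_fintype hAS (fun as => -Real.log (μ.real (S ⁻¹' {as.2}) * Q as.2 as.1)),
      integral_comp_fintype hAS
        (fun as => -Real.log (μ.real (S ⁻¹' {as.2})) + -Real.log (Q as.2 as.1))]
    refine Finset.sum_congr rfl fun as _ => ?_
    -- On null fibres a factor may vanish and the logarithm need not split, but the term carries
    -- weight zero.
    by_cases h : μ.real ((fun x => (A x, S x)) ⁻¹' {as}) = 0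
    · rw [h, zero_mul, zero_mul]
    · rw [Real.log_mul (hp as h).1.ne' (hp as h).2.ne', neg_add]
  linarith

theorem partitionEntropy_prodMk_le_add {A : Ω → ι} (hA : Measurable A) {S : Ω → κ}
    (hS : Measurable S) :
    partitionEntropy μ (fun x => (A x, S x)) ≤ partitionEntropy μ S + partitionEntropy μ A := by
  rw [partitionEntropy_eq_integral hA]
  exact partitionEntropy_prodMk_le hA hS (Q := fun _ a => μ.real (A ⁻¹' {a}))
    (fun _ _ => measureReal_nonneg) (fun _ => (sum_measureReal_fiber hA).le)
    (fun _ _ h => lt_of_le_of_ne measureReal_nonneg h.symm)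

theorem subadditive_partitionEntropy_itinerary {T : Ω → Ω} (hT : MeasurePreserving T μ μ)
    {α : Ω → ι} (hα : Measurable α) :
    Subadditive fun n => partitionEntropy μ (itinerary T α n) := by
  intro m n
  have hm := measurable_itinerary hT.measurable hα m
  have hn := measurable_itinerary hT.measurable hα n
  have h := partitionEntropy_prodMk_le_add (μ := μ) hm (hn.comp (hT.measurable.iterate m))
  have h1 : partitionEntropy μ (itinerary T α n ∘ T^[m]) = partitionEntropy μ (itinerary T α n) :=
    partitionEntropy_comp (hT.iterate m) hn
  rw [h1, ← partitionEntropy_equiv (Fin.appendEquiv m n)] at h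
  have h2 : (fun x => Fin.appendEquiv m n (itinerary T α m x, (itinerary T α n ∘ T^[m]) x)) =
      itinerary T α (m + n) := by
    funext x
    rw [Fin.appendEquiv]
    funext i
    refine Fin.addCases (fun i => ?_) (fun i => ?_) i
    · simp [itinerary]
    · simp [itinerary, Nat.add_comm m, Function.iterate_add_apply]
  rw [h2] at h
  dsimp only
  linarith

end FiniteEntropy

theorem integral_comp_of_measurePreserving {Ω : Type*} [MeasurableSpace Ω] {μ : Measure Ω}
    {T : Ω → Ω} (hT : MeasurePreserving T μ μ) {φ : Ω → ℝ} (hφ : Measurable φ) :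
    ∫ x, φ (T x) ∂μ = ∫ x, φ x ∂μ := by
  conv_rhs => rw [← hT.map_eq]
  exact (integral_map hT.measurable.aemeasurable hφ.aestronglyMeasurable).symm

/-! ### Cylinders and approximation by initial words. -/

section Words

variable {k : ℕ} (X : Subshift (Fin k) ℕ)

/-- The initial word of length `n` of a point. -/
def word (n : ℕ) (x : X.carrier) : Fin n → Fin k := fun i => x.1 i

theorem measurable_word (n : ℕ) : Measurable (word X n) :=
  measurable_pi_lambda _ fun i => (measurable_pi_apply (i : ℕ)).comp measurable_subtype_coe

theorem cyl_eq_word_preimage (n : ℕ) (x : X.carrier) :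
    cyl X n x = word X n ⁻¹' {word X n x} := by
  ext z
  simp only [cyl, mem_ofPred_eq, mem_preimage, mem_singleton_iff, funext_iff, word]
  exact ⟨fun h i => h i i.2, fun h i hi => h ⟨i, hi⟩⟩

theorem measurableSet_cyl (n : ℕ) (x : X.carrier) : MeasurableSet (cyl X n x) := by
  rw [cyl_eq_word_preimage]
  exact measurable_word X n (measurableSet_singleton _)

theorem mem_cyl_self (n : ℕ) (x : X.carrier) : x ∈ cyl X n x := fun _ _ => rfl

theorem cyl_eq_of_mem {n : ℕ} {x y : X.carrier} (h : y ∈ cyl X n x) : cyl X n y = cyl X n x := by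
  ext z
  exact ⟨fun hz i hi => (hz i hi).trans (h i hi), fun hz i hi => (hz i hi).trans (h i hi).symm⟩

theorem cyl_anti {m n : ℕ} (h : m ≤ n) (x : X.carrier) : cyl X n x ⊆ cyl X m x :=
  fun _ hz i hi => hz i (hi.trans_le h)

theorem sigma_apply (x : X.carrier) (i : ℕ) : (sigma X x).1 i = x.1 (i + 1) := by
  rw [Nat.add_comm i]
  rfl

theorem sigma_iterate_apply (n : ℕ) (x : X.carrier) (i : ℕ) :
    ((sigma X)^[n] x).1 i = x.1 (i + n) := by
  induction n generalizing i with
  | zero => rfl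
  | succ n ih =>
    rw [Function.iterate_succ_apply', sigma_apply, ih, Nat.add_right_comm, Nat.add_assoc]

theorem measurable_sigma : Measurable (sigma X) :=
  Measurable.subtype_mk (f := fun x : X.carrier => SymbolicDynamics.FullShift.shift 1 x.1)
    (measurable_pi_lambda _ fun i => (measurable_pi_apply (1 + i)).comp measurable_subtype_coe)

theorem word_eq_itinerary (n : ℕ) :
    word X n = itinerary (sigma X) (fun x : X.carrier => x.1 0) n := by
  funext x i
  simp [itinerary, sigma_iterate_apply, word]

theorem measurable_apply_zero : Measurable (fun x : X.carrier => x.1 0) :=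
  (measurable_pi_apply 0).comp measurable_subtype_coe

/-- The largest union of `n`-cylinders contained in `U`. -/
def cylInterior (n : ℕ) (U : Set X.carrier) : Set X.carrier := {x | cyl X n x ⊆ U}

theorem cylInterior_subset (n : ℕ) (U : Set X.carrier) : cylInterior X n U ⊆ U :=
  fun x hx => hx (mem_cyl_self X n x)

theorem monotone_cylInterior (U : Set X.carrier) : Monotone fun n => cylInterior X n U :=
  fun _ _ h x hx => (cyl_anti X h x).trans hx

theorem cylInterior_eq_preimage (n : ℕ) (U : Set X.carrier) :
    cylInterior X n U = word X n ⁻¹' {s | word X n ⁻¹' {s} ⊆ U} := by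
  ext x
  simp only [cylInterior, mem_ofPred_eq, mem_preimage, cyl_eq_word_preimage]

theorem measurableSet_cylInterior (n : ℕ) (U : Set X.carrier) :
    MeasurableSet (cylInterior X n U) := by
  rw [cylInterior_eq_preimage]
  exact measurable_word X n (Set.toFinite _).measurableSet

theorem exists_cyl_subset {U : Set X.carrier} (hU : IsOpen U) {x : X.carrier} (hx : x ∈ U) :
    ∃ n, cyl X n x ⊆ U := by
  obtain ⟨V, hV, rfl⟩ := isOpen_induced_iff.1 hU
  obtain ⟨I, u, hu, hIu⟩ := isOpen_pi_iff.1 hV x.1 hx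
  refine ⟨I.sup id + 1, fun z hz => hIu fun i hi => ?_⟩
  have : i < I.sup id + 1 := Nat.lt_succ_of_le (Finset.le_sup (f := id) hi)
  rw [hz i this]
  exact (hu i hi).2

theorem iUnion_cylInterior {U : Set X.carrier} (hU : IsOpen U) :
    ⋃ n, cylInterior X n U = U :=
  Subset.antisymm (iUnion_subset fun n => cylInterior_subset X n U) fun _ hx =>
    let ⟨n, hn⟩ := exists_cyl_subset X hU hx
    mem_iUnion.2 ⟨n, hn⟩

theorem tendsto_measure_cylInterior (μ : Measure X.carrier) {U : Set X.carrier} (hU : IsOpen U) :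
    Tendsto (fun n => μ (cylInterior X n U)) atTop (𝓝 (μ U)) := by
  have h := tendsto_measure_iUnion_atTop (μ := μ) (monotone_cylInterior X U)
  rwa [iUnion_cylInterior X hU] at h

theorem measure_word_preimage (μ : Measure X.carrier) (n : ℕ) (S : Set (Fin n → Fin k)) :
    μ (word X n ⁻¹' S) = ∑ s ∈ S.toFinite.toFinset, μ (word X n ⁻¹' {s}) := by
  rw [sum_measure_preimage_singleton _ fun s _ =>
    measurable_word X n (measurableSet_singleton s)]
  simp

/-- An inequality between measures that holds on cylinders holds everywhere. -/
theorem measure_le_of_cyl_le {μ₁ μ₂ : Measure X.carrier} [IsFiniteMeasure μ₂]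
    (h : ∀ n ≥ 1, ∀ x, μ₁ (cyl X n x) ≤ μ₂ (cyl X n x)) : μ₁ ≤ μ₂ := by
  -- An open set is the increasing union of its cylinder interiors, each a finite disjoint union of
  -- cylinders. Outer regularity of `μ₂` then reaches all measurable sets.
  have hopen : ∀ U : Set X.carrier, IsOpen U → μ₁ U ≤ μ₂ U := by
    intro U hU
    refine le_of_tendsto_of_tendsto (tendsto_measure_cylInterior X μ₁ hU)
      (tendsto_measure_cylInterior X μ₂ hU) ?_
    filter_upwards [eventually_ge_atTop 1] with n hn
    rw [cylInterior_eq_preimage, measure_word_preimage, measure_word_preimage]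
    refine Finset.sum_le_sum fun s _ => ?_
    rcases (word X n ⁻¹' {s}).eq_empty_or_nonempty with he | ⟨x, hx⟩
    · simp [he]
    · rw [← show word X n x = s from hx, ← cyl_eq_word_preimage]
      exact h n hn x
  refine Measure.le_intro fun A _ _ => ?_
  rw [A.measure_eq_iInf_isOpen μ₂]
  exact le_iInf fun U => le_iInf fun hAU => le_iInf fun hU => (measure_mono hAU).trans (hopen U hU)

/-- Every finite measurable partition is approximated by functions of initial words. -/
theorem exists_word_approx (μ : Measure X.carrier) [IsProbabilityMeasure μ] {m : ℕ}
    {α : X.carrier → Fin m} (hα : Measurable α) {ε : ℝ} (hε : 0 < ε) :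
    ∃ (j : ℕ) (g : (Fin j → Fin k) → Fin m), μ.real {x | α x ≠ g (word X j x)} ≤ ε := by
  classical
  obtain ⟨x₀⟩ := nonempty_of_isProbabilityMeasure μ
  have hm : 0 < m := (α x₀).pos
  have hδ : 0 < ε / (2 * m) := by positivity
  have hU : ∀ a, ∃ U ⊇ α ⁻¹' {a}, IsOpen U ∧ μ.real (U \ α ⁻¹' {a}) ≤ ε / (2 * m) := by
    intro a
    obtain ⟨U, hsub, hUo, hlt⟩ := (α ⁻¹' {a}).exists_isOpen_lt_add (μ := μ)
      (measure_ne_top _ _) (ε := ENNReal.ofReal (ε / (2 * m))) (by simpa using hδ)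
    refine ⟨U, hsub, hUo, ?_⟩
    rw [measureReal_sdiff hsub (hα (measurableSet_singleton a)), sub_le_iff_le_add']
    have := ENNReal.toReal_mono (by finiteness) hlt.le
    rwa [ENNReal.toReal_add (by finiteness) (by finiteness), ENNReal.toReal_ofReal hδ.le] at this
  choose U hsub hUo hUm using hU
  have hj : ∀ᶠ j in atTop, ∀ a, μ.real (U a \ cylInterior X j (U a)) ≤ ε / (2 * m) := by
    refine eventually_all.2 fun a => ?_
    have h1 : Tendsto (fun j => μ.real (cylInterior X j (U a))) atTop (𝓝 (μ.real (U a))) :=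
      (ENNReal.tendsto_toReal (measure_ne_top _ _)).comp
        (tendsto_measure_cylInterior X μ (hUo a))
    filter_upwards [h1.eventually (lt_mem_nhds (sub_lt_self _ hδ))] with j hj
    rw [measureReal_sdiff (cylInterior_subset X j (U a)) (measurableSet_cylInterior X j (U a))]
    linarith
  obtain ⟨j, hj⟩ := hj.exists
  -- Guess any `a` whose neighbourhood `U a` contains the whole cylinder. A wrong guess puts the
  -- point either in `U a` outside the fibre of `a`, or in `U (α x)` outside its cylinder interior.
  refine ⟨j, fun s => if h : ∃ a, word X j ⁻¹' {s} ⊆ U a then h.choose else α x₀, ?_⟩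
  have hcover : {x | α x ≠ if h : ∃ a, word X j ⁻¹' {word X j x} ⊆ U a then h.choose else α x₀} ⊆
      ⋃ a, (U a \ α ⁻¹' {a} ∪ U a \ cylInterior X j (U a)) := by
    intro x hx
    by_cases hc : x ∈ cylInterior X j (U (α x))
    · have h : ∃ a, word X j ⁻¹' {word X j x} ⊆ U a :=
        ⟨α x, by rwa [← cyl_eq_word_preimage]⟩
      rw [mem_ofPred_eq, dif_pos h] at hx
      exact mem_iUnion.2 ⟨h.choose, Or.inl ⟨h.choose_spec rfl, hx⟩⟩
    · exact mem_iUnion.2 ⟨α x, Or.inr ⟨hsub _ rfl, hc⟩⟩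
  calc _ ≤ _ := measureReal_mono hcover
    _ ≤ ∑ a, μ.real (U a \ α ⁻¹' {a} ∪ U a \ cylInterior X j (U a)) := measureReal_iUnion_fintype_le _
    _ ≤ ∑ _a : Fin m, (ε / (2 * m) + ε / (2 * m)) := Finset.sum_le_sum fun a _ =>
        (measureReal_union_le _ _).trans (add_le_add (hUm a) (hj a))
    _ = ε := by
        have : (m : ℝ) ≠ 0 := by positivity
        simp only [Finset.sum_const, Finset.card_univ, Fintype.card_fin, nsmul_eq_mul]
        field_simp
        norm_num

end Words

/-! ### The generator theorem for the first-letter partition. -/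

section GeneratorEntropy

variable {k : ℕ} {X : Subshift (Fin k) ℕ} {μ : Measure X.carrier}

/-- The first n + j letters show the length-j window at each time i < n. Coding each symbol of the
`α`-itinerary from its window with weights `q` costs the same expected amount at every time, by
invariance. -/
theorem partitionEntropy_itinerary_le [IsProbabilityMeasure μ]
    (hT : MeasurePreserving (sigma X) μ μ) {m : ℕ} {α : X.carrier → Fin m} (hα : Measurable α)
    {j : ℕ} {q : (Fin j → Fin k) → Fin m → ℝ} (hq : ∀ s a, 0 < q s a)
    (hq1 : ∀ s, ∑ a, q s a ≤ 1) (n : ℕ) :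
    partitionEntropy μ (itinerary (sigma X) α n) ≤
      partitionEntropy μ (word X (n + j)) + n * ∫ x, -Real.log (q (word X j x) (α x)) ∂μ := by
  have hA := measurable_itinerary hT.measurable hα n
  have hS := measurable_word X (n + j)
  have h1 := partitionEntropy_le_prodMk (μ := μ) hS hA
  rw [← partitionEntropy_equiv (Equiv.prodComm _ _)] at h1
  have h2 := partitionEntropy_prodMk_le (μ := μ) hA hS
    (Q := fun s a => ∏ i : Fin n, q (fun l : Fin j => s ⟨l + i, by omega⟩) (a i))
    (fun s a => Finset.prod_nonneg fun i _ => (hq _ _).le)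
    (fun s => by
      have := (Finset.prod_univ_sum (fun _ : Fin n => (Finset.univ : Finset (Fin m)))
        (fun i a => q (fun l : Fin j => s ⟨l + i, by omega⟩) a)).symm
      rw [Fintype.piFinset_univ] at this
      rw [this]
      exact Finset.prod_le_one (fun i _ => Finset.sum_nonneg fun a _ => (hq _ _).le)
        fun i _ => hq1 _)
    (fun s a _ => Finset.prod_pos fun i _ => hq _ _)
  refine h1.trans (h2.trans (add_le_add_right (le_of_eq ?_) _))
  have hαj := hα.prodMk (measurable_word X j)
  have hφ : Measurable fun x => -Real.log (q (word X j x) (α x)) :=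
    (measurable_of_finite fun p : Fin m × (Fin j → Fin k) => -Real.log (q p.2 p.1)).comp hαj
  have hi : Integrable (fun x => -Real.log (q (word X j x) (α x))) μ :=
    integrable_comp_fintype hαj (fun p : Fin m × (Fin j → Fin k) => -Real.log (q p.2 p.1))
  have h3 : ∀ x, -Real.log (∏ i : Fin n, q (fun l : Fin j => word X (n + j) x ⟨l + i, by omega⟩)
      (itinerary (sigma X) α n x i)) =
      ∑ i : Fin n, -Real.log (q (word X j ((sigma X)^[i] x)) (α ((sigma X)^[i] x))) := by
    intro x
    rw [Real.log_prod fun i _ => (hq _ _).ne', Finset.sum_neg_distrib]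
    congr 1
    refine Finset.sum_congr rfl fun i _ => ?_
    congr 2
    funext l
    simp [word, sigma_iterate_apply]
  simp_rw [h3]
  rw [integral_finsetSum (f := fun (i : Fin n) x =>
      -Real.log (q (word X j ((sigma X)^[i] x)) (α ((sigma X)^[i] x)))) _ fun (i : Fin n) _ =>
    (hT.iterate i).integrable_comp_of_integrable hi, Finset.sum_congr rfl fun (i : Fin n) _ =>
    integral_comp_of_measurePreserving (hT.iterate i) hφ]
  simp

/-- Weight exp(−c/2) goes to the symbol predicted by `g`, and `ε` to every other one. A correct
prediction costs c/2; a wrong one costs −log ε, but is made improbable. Since `ε` does not depend on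
`j`, the accuracy can be chosen after it. -/
theorem exists_weights [IsProbabilityMeasure μ] {m : ℕ} {α : X.carrier → Fin m}
    (hα : Measurable α) {c : ℝ} (hc : 0 < c) :
    ∃ (j : ℕ) (q : (Fin j → Fin k) → Fin m → ℝ), (∀ s a, 0 < q s a) ∧ (∀ s, ∑ a, q s a ≤ 1) ∧
      ∫ x, -Real.log (q (word X j x) (α x)) ∂μ ≤ c := by
  classical
  obtain ⟨x₀⟩ := nonempty_of_isProbabilityMeasure μ
  have hm : (0 : ℝ) < m := Nat.cast_pos.2 (α x₀).pos
  have he : Real.exp (-(c / 2)) < 1 := Real.exp_lt_one_iff.2 (by linarith)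
  set ε := (1 - Real.exp (-(c / 2))) / m with hεdef
  have hε : 0 < ε := div_pos (by linarith) hm
  obtain ⟨j, g, hg⟩ := exists_word_approx X μ hα
    (ε := c / (2 * (|Real.log ε| + 1))) (by positivity)
  refine ⟨j, fun s a => if a = g s then Real.exp (-(c / 2)) else ε, fun s a => ?_, fun s => ?_, ?_⟩
  · dsimp only
    split_ifs
    · positivity
    · exact hε
  · calc ∑ a, (if a = g s then Real.exp (-(c / 2)) else ε)
        ≤ ∑ a, ((if a = g s then Real.exp (-(c / 2)) else 0) + ε) := by
          refine Finset.sum_le_sum fun a _ => ?_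
          split_ifs <;> linarith
      _ = 1 := by
          rw [Finset.sum_add_distrib, Finset.sum_ite_eq' Finset.univ, hεdef]
          simp only [Finset.mem_univ, if_true, Finset.sum_const, Finset.card_univ,
            Fintype.card_fin, nsmul_eq_mul]
          rw [mul_div_cancel₀ _ hm.ne']
          ring
  · have hαj := hα.prodMk (measurable_word X j)
    have hB : MeasurableSet {x | α x ≠ g (word X j x)} :=
      (measurableSet_eq_fun hα ((measurable_of_finite g).comp (measurable_word X j))).compl
    calc ∫ x, -Real.log (if α x = g (word X j x) then Real.exp (-(c / 2)) else ε) ∂μ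
        ≤ ∫ x, (c / 2 + {x | α x ≠ g (word X j x)}.indicator (fun _ => |Real.log ε|) x) ∂μ := by
          refine integral_mono (integrable_comp_fintype hαj (fun p : Fin m × (Fin j → Fin k) =>
            -Real.log (if p.1 = g p.2 then Real.exp (-(c / 2)) else ε)))
            ((integrable_const _).add ((integrable_const _).indicator hB)) fun x => ?_
          by_cases h : α x = g (word X j x)
          · simp [h]
          · have := neg_le_abs (Real.log ε)
            simp only [h, if_false, ne_eq, not_false_eq_true, indicator, mem_ofPred_eq, if_true]
            linarith
      _ = c / 2 + μ.real {x | α x ≠ g (word X j x)} * |Real.log ε| := by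
          rw [integral_add (integrable_const _) ((integrable_const _).indicator hB),
            integral_indicator_const _ hB]
          simp
      _ ≤ c / 2 + c / (2 * (|Real.log ε| + 1)) * (|Real.log ε| + 1) := by
          gcongr
          linarith
      _ = c := by
          have : |Real.log ε| + 1 ≠ 0 := by positivity
          field_simp
          norm_num

/-- The generator theorem for the partition of a subshift according to the first letter: the
entropy of an invariant measure is the growth rate of the entropies of the partitions into
cylinders, and these dominate it. -/
theorem exists_entropy_eq (hμ : μ ∈ invMeasures X) :
    ∃ h : ℝ, entropy (sigma X) μ = h ∧
      Tendsto (fun n : ℕ => partitionEntropy μ (word X n) / n) atTop (𝓝 h) ∧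
      ∀ n : ℕ, n * h ≤ partitionEntropy μ (word X n) := by
  have := hμ.1
  have hT := hμ.2
  have hsub := subadditive_partitionEntropy_itinerary hT (measurable_apply_zero X)
  simp only [← word_eq_itinerary] at hsub
  have hbdd := bddBelow_partitionEntropy_div (μ := μ) (word X)
  have hlim := hsub.tendsto_lim hbdd
  refine ⟨hsub.lim, le_antisymm ?_ ?_, hlim, fun n => ?_⟩
  · refine iSup_le fun m => iSup_le fun α => iSup_le fun hα => ?_
    refine EReal.le_of_forall_lt_iff_le.1 fun z hz => ?_
    rw [EReal.coe_lt_coe_iff] at hz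
    -- The coding cost per symbol is z − h, and the j extra letters contribute only a bounded
    -- entropy, which vanishes after division by n.
    obtain ⟨j, q, hq, hq1, hqi⟩ := exists_weights (μ := μ) hα (sub_pos.2 hz)
    have hb : Tendsto (fun n : ℕ => partitionEntropy μ (word X n) / n +
        partitionEntropy μ (word X j) / n + (z - hsub.lim)) atTop (𝓝 z) := by
      have := (hlim.add (tendsto_const_div_atTop_nhds_zero_nat
        (partitionEntropy μ (word X j)))).add_const (z - hsub.lim)
      simpa using this
    rw [← ((continuous_coe_real_ereal.tendsto _).comp hb).limsup_eq]
    refine limsup_le_limsup ?_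
    filter_upwards [eventually_gt_atTop 0] with n hn
    refine EReal.coe_le_coe_iff.2 ?_
    have hn' : (0 : ℝ) < n := Nat.cast_pos.2 hn
    dsimp only
    rw [← add_div, div_add' _ _ _ hn'.ne']
    gcongr
    have h1 := partitionEntropy_itinerary_le hT hα hq hq1 n
    have h2 := hsub n j
    have h3 := mul_le_mul_of_nonneg_left hqi hn'.le
    dsimp only at h2
    change partitionEntropy μ (itinerary (sigma X) α n) ≤ _
    linarith
  · refine le_iSup_of_le k (le_iSup_of_le (fun x => x.1 0) (le_iSup_of_le
      (measurable_apply_zero X) (le_of_eq ?_)))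
    refine (Tendsto.limsup_eq ?_).symm
    refine (continuous_coe_real_ereal.tendsto _).comp ?_
    exact hlim.congr fun n => by rw [word_eq_itinerary]; rfl
  · rcases eq_or_ne n 0 with rfl | hn
    · simpa using partitionEntropy_nonneg (μ := μ) _
    · have h := hsub.lim_le_div hbdd hn
      rwa [le_div_iff₀ (by positivity), mul_comm] at h

end GeneratorEntropy

/-! ### The limit potential and its Birkhoff sums. -/

section Potential

variable {k : ℕ} {X : Subshift (Fin k) ℕ} {ν : Measure X.carrier} {P : ℝ} {r : X.carrier → ℝ}

theorem logRatio_eq_sub (hpos : ∀ n x, 0 < ν.real (cyl X n x)) (n : ℕ) (x : X.carrier) :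
    logRatio X ν n x =
      Real.log (ν.real (cyl X (n + 1) x)) - Real.log (ν.real (cyl X n (sigma X x))) :=
  Real.log_div (hpos _ _).ne' (hpos _ _).ne'

theorem measurable_comp_cyl (ν : Measure X.carrier) (φ : ℝ → ℝ) (n : ℕ) :
    Measurable fun x => φ (ν.real (cyl X n x)) := by
  simp only [cyl_eq_word_preimage]
  exact (measurable_of_finite fun s => φ (ν.real (word X n ⁻¹' {s}))).comp (measurable_word X n)

theorem integrable_comp_cyl (ν μ : Measure X.carrier) [IsProbabilityMeasure μ] (φ : ℝ → ℝ)
    (n : ℕ) : Integrable (fun x => φ (ν.real (cyl X n x))) μ := by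
  simp only [cyl_eq_word_preimage]
  exact integrable_comp_fintype (measurable_word X n) fun s => φ (ν.real (word X n ⁻¹' {s}))

theorem measurable_logRatio (n : ℕ) : Measurable (logRatio X ν n) :=
  Real.measurable_log.comp ((measurable_comp_cyl ν id (n + 1)).div
    ((measurable_comp_cyl ν id n).comp (measurable_sigma X)))

theorem exists_isLimitPotential (hr : ∀ x, rLower X ν P x = rUpper X ν P x) {K : ℝ}
    (hK : ∀ n ≥ 1, ∀ x, |logRatio X ν n x + P| ≤ K) : ∃ r, IsLimitPotential X ν P r := by
  suffices h : ∀ x, ∃ l : ℝ, Tendsto (fun n => logRatio X ν n x) atTop (𝓝 l) by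
    choose l hl using h
    exact ⟨fun x => l x + P, fun x => (hl x).add_const P⟩
  intro x
  have hx : liminf (fun n => (logRatio X ν n x : EReal)) atTop =
      limsup (fun n => (logRatio X ν n x : EReal)) atTop := by
    -- `P` is real, so it cancels even where the limits might be infinite.
    have h := congrArg (fun y : EReal => y + ((-P : ℝ) : EReal)) (hr x)
    have hP : (P : EReal) + ((-P : ℝ) : EReal) = 0 := by
      rw [← EReal.coe_add, add_neg_cancel, EReal.coe_zero]
    simpa only [rLower, rUpper, add_assoc, hP, add_zero] using h
  have ht := tendsto_of_liminf_eq_limsup hx rfl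
  have hge : ((-K - P : ℝ) : EReal) ≤ limsup (fun n => (logRatio X ν n x : EReal)) atTop := by
    refine ge_of_tendsto ht ?_
    filter_upwards [eventually_ge_atTop 1] with n hn
    exact EReal.coe_le_coe_iff.2 (by linarith [(abs_le.1 (hK n hn x)).1])
  have hle : limsup (fun n => (logRatio X ν n x : EReal)) atTop ≤ ((K - P : ℝ) : EReal) := by
    refine le_of_tendsto ht ?_
    filter_upwards [eventually_ge_atTop 1] with n hn
    exact EReal.coe_le_coe_iff.2 (by linarith [(abs_le.1 (hK n hn x)).2])
  generalize limsup (fun n => (logRatio X ν n x : EReal)) atTop = l at ht hge hle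
  induction l using EReal.rec with
  | bot => exact absurd hge (EReal.bot_lt_coe _).not_ge
  | top => exact absurd hle (EReal.coe_lt_top _).not_ge
  | coe l => exact ⟨l, EReal.tendsto_coe.1 ht⟩

theorem IsLimitPotential.measurable (hr : IsLimitPotential X ν P r) : Measurable r :=
  measurable_of_tendsto_metrizable (fun n => (measurable_logRatio n).add_const P)
    (tendsto_pi_nhds.2 hr)

theorem IsLimitPotential.abs_apply_le (hr : IsLimitPotential X ν P r) {K : ℝ}
    (hK : ∀ n ≥ 1, ∀ x, |logRatio X ν n x + P| ≤ K) (x : X.carrier) : |r x| ≤ K :=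
  le_of_tendsto (hr x).abs ((eventually_ge_atTop 1).mono fun n hn => hK n hn x)

theorem IsLimitPotential.integrable (hr : IsLimitPotential X ν P r) {K : ℝ}
    (hK : ∀ n ≥ 1, ∀ x, |logRatio X ν n x + P| ≤ K) (μ : Measure X.carrier)
    [IsProbabilityMeasure μ] : Integrable r μ :=
  Integrable.of_bound hr.measurable.aestronglyMeasurable K
    (Eventually.of_forall fun x => hr.abs_apply_le hK x)

/-- The logarithm of the measure of a long cylinder grows like the integral of the potential. -/
theorem IsLimitPotential.tendsto_integral_log_cyl (hr : IsLimitPotential X ν P r)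
    (hpos : ∀ n x, 0 < ν.real (cyl X n x)) {K : ℝ}
    (hK : ∀ n ≥ 1, ∀ x, |logRatio X ν n x + P| ≤ K) {μ : Measure X.carrier}
    (hμ : μ ∈ invMeasures X) :
    Tendsto (fun n : ℕ => (∫ x, Real.log (ν.real (cyl X n x)) ∂μ) / n) atTop
      (𝓝 (∫ x, r x ∂μ - P)) := by
  have := hμ.1
  have h1 : Tendsto (fun n => ∫ x, (logRatio X ν n x + P) ∂μ) atTop (𝓝 (∫ x, r x ∂μ)) := by
    refine tendsto_integral_filter_of_dominated_convergence (fun _ => K)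
      (Eventually.of_forall fun n => ((measurable_logRatio n).add_const P).aestronglyMeasurable)
      ?_ (integrable_const K) (Eventually.of_forall hr)
    filter_upwards [eventually_ge_atTop 1] with n hn
    exact Eventually.of_forall fun x => hK n hn x
  have h2 : ∀ n, ∫ x, (logRatio X ν n x + P) ∂μ =
      -- Invariance of μ removes the shift in the denominator, leaving a telescoping sequence for
      -- Cesàro averaging.
      (∫ x, Real.log (ν.real (cyl X (n + 1) x)) ∂μ - ∫ x, Real.log (ν.real (cyl X n x)) ∂μ) + P := by
    intro n
    have hi := integrable_comp_cyl ν μ Real.log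
    have hi' : Integrable (fun x => Real.log (ν.real (cyl X n (sigma X x)))) μ :=
      hμ.2.integrable_comp_of_integrable (hi n)
    have hs : Integrable (fun x => Real.log (ν.real (cyl X (n + 1) x)) -
      Real.log (ν.real (cyl X n (sigma X x)))) μ := (hi (n + 1)).sub hi'
    simp_rw [logRatio_eq_sub hpos]
    rw [integral_add hs (integrable_const P), integral_sub (hi (n + 1)) hi',
      integral_comp_of_measurePreserving hμ.2 (measurable_comp_cyl ν Real.log n)]
    simp
  have h3 := (h1.congr h2).sub_const P
  simp only [add_sub_cancel_right] at h3
  have h4 := h3.cesaro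
  simp only [Finset.sum_range_sub fun n => ∫ x, Real.log (ν.real (cyl X n x)) ∂μ] at h4
  have h5 := h4.add (tendsto_const_div_atTop_nhds_zero_nat
    (∫ x, Real.log (ν.real (cyl X 0 x)) ∂μ))
  rw [add_zero] at h5
  refine h5.congr fun n => ?_
  rw [inv_mul_eq_div, ← add_div, sub_add_cancel]

theorem IsLimitPotential.integralLimits (hr : IsLimitPotential X ν P r)
    (hpos : ∀ n x, 0 < ν.real (cyl X n x)) {K : ℝ}
    (hK : ∀ n ≥ 1, ∀ x, |logRatio X ν n x + P| ≤ K) {f : ℕ → X.carrier → ℝ}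
    (hf : IsContSeq X f) {D : ℝ}
    (hD : ∀ n ≥ 1, ∀ x, |Real.log (ν.real (cyl X n x)) + n * P - Real.log (f n x)| ≤ D) :
    IntegralLimits X f ν P r := by
  intro μ hμ
  have := hμ.1
  have hi := integrable_comp_cyl ν μ Real.log
  have h1 := (hr.tendsto_integral_log_cyl hpos hK hμ).add_const P
  rw [sub_add_cancel] at h1
  have h2 : Tendsto (fun n : ℕ => (1 / n : ℝ) *
      ∫ x, Real.log (ν.real (cyl X n x) * Real.exp (n * P)) ∂μ) atTop (𝓝 (∫ x, r x ∂μ)) := by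
    refine h1.congr' ?_
    filter_upwards [eventually_gt_atTop 0] with n hn
    have hn' : (n : ℝ) ≠ 0 := by positivity
    simp_rw [fun x => Real.log_mul (hpos n x).ne' (Real.exp_pos (n * P)).ne', Real.log_exp]
    rw [integral_add (hi n) (integrable_const _)]
    simp only [integral_const, probReal_univ, one_smul]
    field_simp
  refine ⟨?_, h2⟩
  have h3 : Tendsto (fun n : ℕ => (1 / n : ℝ) * ∫ x, Real.log (f n x) ∂μ -
      (1 / n : ℝ) * ∫ x, Real.log (ν.real (cyl X n x) * Real.exp (n * P)) ∂μ) atTop (𝓝 0) := by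
    refine squeeze_zero_norm' ?_ (tendsto_const_div_atTop_nhds_zero_nat D)
    filter_upwards [eventually_ge_atTop 1] with n hn
    have hc : CompactSpace X.carrier := isCompact_iff_compactSpace.1 X.isClosed.isCompact
    have hfi : Integrable (fun x => Real.log (f n x)) μ :=
      (Continuous.log (hf n hn).1 fun x => ((hf n hn).2 x).ne').integrable_of_hasCompactSupport
        (HasCompactSupport.of_compactSpace _)
    simp_rw [fun x => Real.log_mul (hpos n x).ne' (Real.exp_pos (n * P)).ne', Real.log_exp]
    have hg : Integrable (fun x => Real.log (ν.real (cyl X n x)) + n * P) μ :=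
      (hi n).add (integrable_const _)
    rw [← mul_sub, ← integral_sub hfi hg, norm_mul, one_div,
      norm_inv, RCLike.norm_natCast, inv_mul_eq_div]
    gcongr
    refine (norm_integral_le_of_norm_le_const (C := D) (Eventually.of_forall fun x => ?_)).trans
      (by simp)
    rw [Real.norm_eq_abs, abs_sub_comm]
    exact hD n hn x
  simpa using h3.add h2

/-- Birkhoff sums of the potential, by telescoping. -/
theorem IsLimitPotential.tendsto_birkhoffSum (hr : IsLimitPotential X ν P r)
    (hpos : ∀ n x, 0 < ν.real (cyl X n x)) (n : ℕ) (x : X.carrier) :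
    Tendsto (fun m => Real.log (ν.real (cyl X (m + n) x)) -
      Real.log (ν.real (cyl X m ((sigma X)^[n] x))) + n * P) atTop
      (𝓝 (birkhoffSum (sigma X) r n x)) := by
  induction n with
  | zero => simp
  | succ n ih =>
    rw [birkhoffSum_succ]
    refine (((tendsto_add_atTop_iff_nat 1).2 ih).add (hr ((sigma X)^[n] x))).congr fun m => ?_
    rw [logRatio_eq_sub hpos, ← Function.iterate_succ_apply' (sigma X), Nat.add_right_comm m 1 n,
      ← Nat.add_assoc m n 1]
    push_cast
    ring

/-- In the telescoped formula, Gibbs comparisons at lengths n + m, n and m cost `D` each, and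
splitting `f (n + m)` costs `C n`. The total is independent of m and survives the limit. -/
theorem IsLimitPotential.abs_birkhoffSum_sub_le (hr : IsLimitPotential X ν P r)
    (hpos : ∀ n x, 0 < ν.real (cyl X n x)) {f : ℕ → X.carrier → ℝ} {C : ℕ → ℝ} {D : ℝ}
    (hD : ∀ n ≥ 1, ∀ x, |Real.log (ν.real (cyl X n x)) + n * P - Real.log (f n x)| ≤ D)
    (hC : ∀ n ≥ 1, ∀ m ≥ 1, ∀ x,
      |Real.log (f (n + m) x) - Real.log (f n x) - Real.log (f m ((sigma X)^[n] x))| ≤ C n)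
    {n : ℕ} (hn : 1 ≤ n) (x : X.carrier) :
    |birkhoffSum (sigma X) r n x - (Real.log (ν.real (cyl X n x)) + n * P)| ≤ C n + 3 * D := by
  refine le_of_tendsto ((hr.tendsto_birkhoffSum hpos n x).sub_const _).abs ?_
  filter_upwards [eventually_ge_atTop 1] with m hm
  have h1 := abs_le.1 (hD (n + m) (by omega) x)
  have h2 := abs_le.1 (hD n hn x)
  have h3 := abs_le.1 (hD m hm ((sigma X)^[n] x))
  have h4 := abs_le.1 (hC n hn m hm x)
  rw [Nat.add_comm m n]
  push_cast at h1
  rw [abs_le]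
  constructor <;> linarith [h1.1, h1.2, h2.1, h2.2, h3.1, h3.2, h4.1, h4.2]

end Potential

/-! ### The variational inequality, with equality at ν. -/

section VariationalPrinciple

variable {k : ℕ} {X : Subshift (Fin k) ℕ} {ν : Measure X.carrier} {P : ℝ} {r : X.carrier → ℝ}

theorem partitionEntropy_word_eq (hν : ν ∈ invMeasures X) (n : ℕ) :
    partitionEntropy ν (word X n) = -∫ x, Real.log (ν.real (cyl X n x)) ∂ν := by
  have := hν.1
  rw [partitionEntropy_eq_integral (measurable_word X n), integral_neg]
  simp only [cyl_eq_word_preimage]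

/-- The relative entropy of `μ` with respect to `ν` on words is nonnegative, with a weight `w`
inserted. -/
theorem partitionEntropy_word_add_le [IsProbabilityMeasure ν]
    (hpos : ∀ n x, 0 < ν.real (cyl X n x)) {μ : Measure X.carrier} [IsProbabilityMeasure μ]
    (n : ℕ) {w : (Fin n → Fin k) → ℝ} (hw : ∀ s, 0 < w s) :
    partitionEntropy μ (word X n) + ∫ x, Real.log (ν.real (cyl X n x)) ∂μ +
      ∫ x, Real.log (w (word X n x)) ∂μ ≤ ∫ x, w (word X n x) ∂ν - 1 := by
  have hm := measurable_word X n
  -- Gibbs' inequality against ν tilted by `w`. Taking w = 1 gives the variational inequality; a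
  -- large weight on a set of words gives absolute continuity.
  have h := partitionEntropy_le_crossEntropy (μ := μ) hm
    (q := fun s => ν.real (word X n ⁻¹' {s}) * w s)
    (fun s => mul_nonneg measureReal_nonneg (hw s).le) (fun s hs => by
      obtain ⟨x, hx⟩ := nonempty_of_measureReal_ne_zero hs
      rw [← show word X n x = s from hx, ← cyl_eq_word_preimage]
      exact mul_pos (hpos n x) (hw _))
  rw [← integral_comp_fintype hm w] at h
  simp only [← cyl_eq_word_preimage] at h
  simp_rw [fun x => Real.log_mul (hpos n x).ne' (hw (word X n x)).ne'] at h
  rw [integral_neg, integral_add (integrable_comp_cyl ν μ Real.log n)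
    (integrable_comp_fintype hm fun s => Real.log (w s))] at h
  linarith

theorem IsLimitPotential.entropy_add_integral_le (hr : IsLimitPotential X ν P r)
    (hν : ν ∈ invMeasures X) (hpos : ∀ n x, 0 < ν.real (cyl X n x)) {K : ℝ}
    (hK : ∀ n ≥ 1, ∀ x, |logRatio X ν n x + P| ≤ K) {μ : Measure X.carrier}
    (hμ : μ ∈ invMeasures X) : entropy (sigma X) μ + ((∫ x, r x ∂μ : ℝ) : EReal) ≤ P := by
  have := hμ.1
  have := hν.1
  obtain ⟨h, he, hlim, -⟩ := exists_entropy_eq hμ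
  rw [he, ← EReal.coe_add, EReal.coe_le_coe_iff]
  have hle : h + (∫ x, r x ∂μ - P) ≤ 0 := by
    refine le_of_tendsto (hlim.add (hr.tendsto_integral_log_cyl hpos hK hμ))
      (Eventually.of_forall fun n => ?_)
    have h1 := partitionEntropy_word_add_le hpos (μ := μ) n (w := fun _ => 1) (fun _ => one_pos)
    simp only [Real.log_one, integral_zero, add_zero, integral_const, probReal_univ, one_smul,
      sub_self] at h1
    rw [← add_div]
    exact div_nonpos_of_nonpos_of_nonneg h1 n.cast_nonneg
  linarith

theorem IsLimitPotential.entropy_add_integral_self (hr : IsLimitPotential X ν P r)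
    (hν : ν ∈ invMeasures X) (hpos : ∀ n x, 0 < ν.real (cyl X n x)) {K : ℝ}
    (hK : ∀ n ≥ 1, ∀ x, |logRatio X ν n x + P| ≤ K) :
    entropy (sigma X) ν + ((∫ x, r x ∂ν : ℝ) : EReal) = P := by
  obtain ⟨h, he, hlim, -⟩ := exists_entropy_eq hν
  rw [he, ← EReal.coe_add, EReal.coe_eq_coe_iff]
  have h1 := (hr.tendsto_integral_log_cyl hpos hK hν).neg
  simp_rw [partitionEntropy_word_eq hν, neg_div] at hlim
  have := tendsto_nhds_unique hlim h1
  linarith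

theorem IsLimitPotential.iSup_entropy_add_integral (hr : IsLimitPotential X ν P r)
    (hν : ν ∈ invMeasures X) (hpos : ∀ n x, 0 < ν.real (cyl X n x)) {K : ℝ}
    (hK : ∀ n ≥ 1, ∀ x, |logRatio X ν n x + P| ≤ K) :
    ⨆ m ∈ invMeasures X, entropy (sigma X) m + ((∫ x, r x ∂m : ℝ) : EReal) = P := by
  refine le_antisymm (iSup₂_le fun m hm => hr.entropy_add_integral_le hν hpos hK hm) ?_
  rw [← hr.entropy_add_integral_self hν hpos hK]
  exact le_iSup₂ (f := fun m (_ : m ∈ invMeasures X) =>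
    entropy (sigma X) m + ((∫ x, r x ∂m : ℝ) : EReal)) ν hν

theorem IsLimitPotential.isEquilibriumFun (hr : IsLimitPotential X ν P r)
    (hν : ν ∈ invMeasures X) (hpos : ∀ n x, 0 < ν.real (cyl X n x)) {K : ℝ}
    (hK : ∀ n ≥ 1, ∀ x, |logRatio X ν n x + P| ≤ K) : IsEquilibriumFun X r ν :=
  ⟨hν, (hr.entropy_add_integral_self hν hpos hK).trans
    (hr.iSup_entropy_add_integral hν hpos hK).symm⟩

/-- Uniqueness of limits forces `L m` to be ∫ r dm on invariant measures, so both variational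
problems coincide. -/
theorem isEquilibriumSeq_iff {f : ℕ → X.carrier → ℝ} (hlim : IntegralLimits X f ν P r)
    (μ : Measure X.carrier) : IsEquilibriumSeq X f μ ↔ IsEquilibriumFun X r μ := by
  constructor
  · rintro ⟨hμ, L, hL, h⟩
    have hLr : ∀ m ∈ invMeasures X, L m = ∫ x, r x ∂m := fun m hm =>
      tendsto_nhds_unique (hL m hm) (hlim m hm).1
    refine ⟨hμ, ?_⟩
    rw [← hLr μ hμ, h]
    exact iSup_congr fun m => iSup_congr fun hm => by rw [hLr m hm]
  · rintro ⟨hμ, h⟩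
    exact ⟨hμ, fun m => ∫ x, r x ∂m, fun m hm => (hlim m hm).1, h⟩

end VariationalPrinciple

/-! ### Absolute continuity of competing measures. -/

section Uniqueness

variable {k : ℕ} {X : Subshift (Fin k) ℕ} {ν : Measure X.carrier} {P : ℝ} {r : X.carrier → ℝ}

/-- If the relative entropies of `μ` with respect to `ν` on words are bounded, then `μ` is
absolutely continuous with respect to `ν`. -/
theorem absolutelyContinuous_of_relativeEntropy_bounded [IsProbabilityMeasure ν]
    (hpos : ∀ n x, 0 < ν.real (cyl X n x)) {μ : Measure X.carrier} [IsProbabilityMeasure μ] {K : ℝ}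
    (hK : ∀ n ≥ 1, -K ≤
      partitionEntropy μ (word X n) + ∫ x, Real.log (ν.real (cyl X n x)) ∂μ) : μ ≪ ν := by
  classical
  -- Tilt by `M` on `S` and by 1 elsewhere. For a ν-null set, an open neighbourhood of ν-mass at
  -- most 1/M gives μ-mass at most (1 + K)/log M, and M → ∞.
  have hword : ∀ n ≥ 1, ∀ M : ℝ, 1 < M → ∀ S : Set (Fin n → Fin k),
      μ.real (word X n ⁻¹' S) * Real.log M ≤ M * ν.real (word X n ⁻¹' S) + K := by
    intro n hn M hM S
    have hS : MeasurableSet (word X n ⁻¹' S) := measurable_word X n (Set.toFinite _).measurableSet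
    have h := partitionEntropy_word_add_le hpos (μ := μ) n (w := fun s => if s ∈ S then M else 1)
      (fun s => by split_ifs <;> linarith)
    have h1 : ∀ x, Real.log (if word X n x ∈ S then M else 1) =
        (word X n ⁻¹' S).indicator (fun _ => Real.log M) x := by
      intro x
      by_cases hx : word X n x ∈ S <;> simp [hx]
    have h2 : ∀ x, (if word X n x ∈ S then M else 1) =
        1 + (word X n ⁻¹' S).indicator (fun _ => M - 1) x := by
      intro x
      by_cases hx : word X n x ∈ S <;> simp [hx]
    simp_rw [h1, h2] at h
    rw [integral_indicator_const _ hS, integral_add (integrable_const _)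
      ((integrable_const _).indicator hS), integral_indicator_const _ hS] at h
    simp only [integral_const, probReal_univ, smul_eq_mul, mul_one] at h
    have h3 := hK n hn
    have h4 : 0 ≤ ν.real (word X n ⁻¹' S) := measureReal_nonneg
    nlinarith
  refine Measure.AbsolutelyContinuous.mk fun B _ hB => ?_
  have hbound : ∀ M : ℝ, 1 < M → μ.real B ≤ (1 + K) / Real.log M := by
    intro M hM
    have hM0 : 0 < M := one_pos.trans hM
    obtain ⟨G, hBG, hG, hlt⟩ := B.exists_isOpen_lt_add (μ := ν) (measure_ne_top _ _)
      (ε := ENNReal.ofReal (1 / M)) (by simpa using hM0)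
    rw [hB, zero_add] at hlt
    have hνG : M * ν.real G ≤ 1 := by
      have := ENNReal.toReal_mono ENNReal.ofReal_ne_top hlt.le
      rw [ENNReal.toReal_ofReal (by positivity), le_div_iff₀ hM0, mul_comm] at this
      exact this
    refine (measureReal_mono hBG).trans (le_of_tendsto
      ((ENNReal.tendsto_toReal (measure_ne_top _ _)).comp (tendsto_measure_cylInterior X μ hG)) ?_)
    filter_upwards [eventually_ge_atTop 1] with n hn
    rw [le_div_iff₀ (Real.log_pos hM)]
    have h1 := hword n hn M hM {s | word X n ⁻¹' {s} ⊆ G}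
    rw [← cylInterior_eq_preimage] at h1
    have h2 : M * ν.real (cylInterior X n G) ≤ M * ν.real G :=
      mul_le_mul_of_nonneg_left (measureReal_mono (cylInterior_subset X n G)) hM0.le
    exact h1.trans (by linarith)
  have hlim : Tendsto (fun M => (1 + K) / Real.log M) atTop (𝓝 0) :=
    Real.tendsto_log_atTop.const_div_atTop _
  have h0 : μ.real B ≤ 0 :=
    ge_of_tendsto hlim ((eventually_gt_atTop 1).mono fun M hM => hbound M hM)
  exact (measureReal_eq_zero_iff).1 (le_antisymm h0 measureReal_nonneg)

/-- Since n h_μ ≤ H_n(μ), integrating the Birkhoff bound gives nP = n h_μ + n∫ r dμ ≤ H_n(μ) + ∫ log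
ν[x₁…xₙ] dμ + nP + K'. Hence the relative entropies are at most `K'`. -/
theorem absolutelyContinuous_of_isEquilibriumFun (hr : IsLimitPotential X ν P r)
    (hν : ν ∈ invMeasures X) (hpos : ∀ n x, 0 < ν.real (cyl X n x)) {K : ℝ}
    (hK : ∀ n ≥ 1, ∀ x, |logRatio X ν n x + P| ≤ K) {K' : ℝ}
    (hK' : ∀ n ≥ 1, ∀ x,
      |birkhoffSum (sigma X) r n x - (Real.log (ν.real (cyl X n x)) + n * P)| ≤ K')
    {μ : Measure X.carrier} (hμr : IsEquilibriumFun X r μ) : μ ≪ ν := by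
  obtain ⟨hμ, he⟩ := hμr
  have := hμ.1
  have := hν.1
  rw [hr.iSup_entropy_add_integral hν hpos hK] at he
  obtain ⟨h, hh, -, hle⟩ := exists_entropy_eq hμ
  rw [hh, ← EReal.coe_add, EReal.coe_eq_coe_iff] at he
  refine absolutelyContinuous_of_relativeEntropy_bounded hpos (K := K') fun n hn => ?_
  have hri := hr.integrable hK μ
  have hi : ∀ i ∈ Finset.range n, Integrable (fun x => r ((sigma X)^[i] x)) μ := fun i _ =>
    (hμ.2.iterate i).integrable_comp_of_integrable hri
  have hS : ∫ x, birkhoffSum (sigma X) r n x ∂μ = n * ∫ x, r x ∂μ := by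
    simp only [birkhoffSum]
    rw [integral_finsetSum _ hi, Finset.sum_congr rfl fun i _ =>
      integral_comp_of_measurePreserving (hμ.2.iterate i) hr.measurable]
    simp
  have hL := integrable_comp_cyl ν μ Real.log n
  have hL' : Integrable (fun x => Real.log (ν.real (cyl X n x)) + (n * P + K')) μ :=
    hL.add (integrable_const _)
  have h1 : ∫ x, birkhoffSum (sigma X) r n x ∂μ ≤
      ∫ x, (Real.log (ν.real (cyl X n x)) + (n * P + K')) ∂μ :=
    integral_mono (integrable_finsetSum _ hi) hL' fun x => by
      have := (abs_le.1 (hK' n hn x)).2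
      dsimp only
      linarith
  rw [hS, integral_add hL (integrable_const _)] at h1
  simp only [integral_const, probReal_univ, one_smul] at h1
  have h2 := hle n
  have h3 : (n : ℝ) * h + n * ∫ x, r x ∂μ = n * P := by rw [← mul_add, he]
  linarith

/-- On n-cylinders μ and exp(n(P − P'))ν are comparable. Summing one comparison over all words
bounds exp(n(P − P')), so P ≤ P', and the other comparison gives μ ≤ C'C ν. -/
theorem GibbsBounds.absolutelyContinuous {f : ℕ → X.carrier → ℝ}
    (hf : ∀ n ≥ 1, ∀ x, 0 < f n x) {μ : Measure X.carrier} [IsProbabilityMeasure μ]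
    [IsProbabilityMeasure ν] {P' C C' : ℝ} (hC : 0 < C) (hC' : 0 < C')
    (hμ : GibbsBounds X f μ P' fun _ => C') (hν : GibbsBounds X f ν P fun _ => C) : μ ≪ ν := by
  have hE : ∀ n : ℕ, Real.exp (-(n * P')) = Real.exp (n * (P - P')) * Real.exp (-(n * P)) := by
    intro n
    rw [← Real.exp_add]
    congr 1
    ring
  have hup : ∀ n : ℕ, n ≥ 1 → ∀ x,
      μ.real (cyl X n x) ≤ C' * C * Real.exp (n * (P - P')) * ν.real (cyl X n x) := by
    intro n hn x
    have h1 := (hμ n hn x).2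
    have h2 := (hν n hn x).1
    have hp := hf n hn x
    rw [div_le_iff₀ (by positivity), hE] at h1
    rw [div_le_div_iff₀ hC (by positivity), one_mul] at h2
    calc _ ≤ _ := h1
      _ = C' * Real.exp (n * (P - P')) * (Real.exp (-(n * P)) * f n x) := by ring
      _ ≤ C' * Real.exp (n * (P - P')) * (ν.real (cyl X n x) * C) := by gcongr
      _ = _ := by ring
  have hlow : ∀ n : ℕ, n ≥ 1 → ∀ x,
      Real.exp (n * (P - P')) * ν.real (cyl X n x) ≤ C * C' * μ.real (cyl X n x) := by
    intro n hn x
    have h1 := (hμ n hn x).1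
    have h2 := (hν n hn x).2
    have hp := hf n hn x
    rw [div_le_iff₀ (by positivity)] at h2
    rw [div_le_div_iff₀ hC' (by positivity), one_mul, hE] at h1
    calc _ ≤ Real.exp (n * (P - P')) * (C * (Real.exp (-(n * P)) * f n x)) := by gcongr
      _ = C * (Real.exp (n * (P - P')) * Real.exp (-(n * P)) * f n x) := by ring
      _ ≤ C * (μ.real (cyl X n x) * C') := by gcongr
      _ = _ := by ring
  have hexp : ∀ n : ℕ, 1 ≤ n → Real.exp (n * (P - P')) ≤ C * C' := by
    intro n hn
    have h := Finset.sum_le_sum fun (s : Fin n → Fin k) (_ : s ∈ Finset.univ) =>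
      show Real.exp (n * (P - P')) * ν.real (word X n ⁻¹' {s}) ≤
          C * C' * μ.real (word X n ⁻¹' {s}) by
        rcases (word X n ⁻¹' {s}).eq_empty_or_nonempty with he | ⟨x, hx⟩
        · simp [he]
        · rw [← show word X n x = s from hx, ← cyl_eq_word_preimage]
          exact hlow n hn x
    rwa [← Finset.mul_sum, ← Finset.mul_sum, sum_measureReal_fiber (measurable_word X n),
      sum_measureReal_fiber (measurable_word X n), mul_one, mul_one] at h
  have hP : P - P' ≤ 0 := by
    by_contra! hlt
    obtain ⟨n, hn⟩ := exists_nat_gt (C * C' / (P - P'))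
    have hn0 : 0 < n := Nat.cast_pos.1 (lt_trans (by positivity) hn)
    have h1 := hexp n hn0
    have h2 := Real.add_one_le_exp (n * (P - P'))
    rw [div_lt_iff₀ hlt] at hn
    linarith
  have hle : μ ≤ ENNReal.ofReal (C' * C) • ν := by
    have : IsFiniteMeasure (ENNReal.ofReal (C' * C) • ν) := ν.smul_finite ENNReal.ofReal_ne_top
    refine measure_le_of_cyl_le X fun n hn x => ?_
    rw [Measure.smul_apply, smul_eq_mul, ← ofReal_measureReal (μ := μ),
      ← ofReal_measureReal (μ := ν), ← ENNReal.ofReal_mul (by positivity)]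
    refine ENNReal.ofReal_le_ofReal ((hup n hn x).trans ?_)
    have : Real.exp (n * (P - P')) ≤ 1 :=
      Real.exp_le_one_iff.2 (mul_nonpos_of_nonneg_of_nonpos n.cast_nonneg hP)
    calc _ ≤ C' * C * 1 * ν.real (cyl X n x) := by gcongr
      _ = _ := by ring
  exact Measure.absolutelyContinuous_of_le_smul hle

end Uniqueness

/-! ### Ergodicity from weak specification. -/

section Ergodicity

variable {k : ℕ} {X : Subshift (Fin k) ℕ} {ν : Measure X.carrier}

theorem ofFn_mem_language (n : ℕ) (x : X.carrier) : List.ofFn (word X n x) ∈ language X :=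
  ⟨x.1, x.2, 0, fun j hj => by simp [word]⟩

/-- Weak specification glues any two cylinders, with a gap of bounded length. -/
theorem WeakSpecification.exists_mem_cyl (hX : WeakSpecification X) :
    ∃ p : ℕ, ∀ n m (x y : X.carrier), ∃ l ≤ p, ∃ z : X.carrier,
      z ∈ cyl X n x ∧ (sigma X)^[n + l] z ∈ cyl X m y := by
  obtain ⟨p, hp⟩ := hX
  refine ⟨p, fun n m x y => ?_⟩
  obtain ⟨w, -, hw, z, hz, i, h⟩ :=
    hp _ (ofFn_mem_language n x) _ (ofFn_mem_language m y)
  refine ⟨w.length, hw, (sigma X)^[i] ⟨z, hz⟩, fun j hj => ?_, fun j hj => ?_⟩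
  · rw [sigma_iterate_apply, Nat.add_comm]
    change z (i + j) = _
    rw [← h j (by simp; omega), List.getElem_append_left (by simp; omega),
      List.getElem_append_left (by simpa using hj)]
    simp [word]
  · rw [sigma_iterate_apply, sigma_iterate_apply,
      show j + (n + w.length) + i = i + (n + w.length + j) by omega]
    change z (i + (n + w.length + j)) = _
    rw [← h (n + w.length + j) (by simp; omega), List.getElem_append_right (by simp)]
    simp [word]

/-- Glue the two cylinders by a connecting word and split the glued cylinder twice, losing 2K. The
gap depends on the cylinders, hence the sum over `l`. -/
theorem exists_gap_mixing [IsProbabilityMeasure ν] (hX : WeakSpecification X)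
    (hpos : ∀ n x, 0 < ν.real (cyl X n x)) {K : ℝ}
    (hK : ∀ n m x, Real.log (ν.real (cyl X n x)) + Real.log (ν.real (cyl X m ((sigma X)^[n] x))) - K
      ≤ Real.log (ν.real (cyl X (n + m) x))) :
    ∃ c : ENNReal, c ≠ 0 ∧ ∃ p : ℕ, ∀ n m (x y : X.carrier),
      c * ν (cyl X n x) * ν (cyl X m y) ≤
        ∑ l ∈ Finset.range (p + 1), ν (cyl X n x ∩ (sigma X)^[n + l] ⁻¹' cyl X m y) := by
  obtain ⟨p, hp⟩ := hX.exists_mem_cyl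
  -- There are finitely many p-cylinders, and a connecting cylinder of length l ≤ p contains one of
  -- them.
  obtain ⟨E, hE⟩ : BddBelow (range fun x => Real.log (ν.real (cyl X p x))) := by
    refine ((Set.finite_range fun s : Fin p → Fin k =>
      Real.log (ν.real (word X p ⁻¹' {s}))).subset ?_).bddBelow
    rintro _ ⟨x, rfl⟩
    exact ⟨word X p x, by simp only [cyl_eq_word_preimage]⟩
  refine ⟨ENNReal.ofReal (Real.exp (E - 2 * K)), by simpa using Real.exp_pos _, p, fun n m x y => ?_⟩
  obtain ⟨l, hl, z, hzx, hzy⟩ := hp n m x y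
  have h1 := hK (n + l) m z
  have h2 := hK n l z
  have h3 : E ≤ Real.log (ν.real (cyl X l ((sigma X)^[n] z))) :=
    (hE ⟨(sigma X)^[n] z, rfl⟩).trans (Real.log_le_log (hpos _ _) (measureReal_mono (cyl_anti X hl _)))
  rw [cyl_eq_of_mem X hzx] at h2
  rw [cyl_eq_of_mem X hzy] at h1
  have hsub : cyl X (n + l + m) z ⊆ cyl X n x ∩ (sigma X)^[n + l] ⁻¹' cyl X m y := by
    intro t ht
    refine ⟨fun i hi => (ht i (by omega)).trans (hzx i hi), fun i hi => ?_⟩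
    rw [← hzy i hi, sigma_iterate_apply, sigma_iterate_apply]
    exact ht _ (by omega)
  have h4 : Real.exp (E - 2 * K) * ν.real (cyl X n x) * ν.real (cyl X m y) ≤
      ν.real (cyl X (n + l + m) z) := by
    rw [← Real.exp_log (hpos n x), ← Real.exp_log (hpos m y),
      ← Real.exp_log (hpos (n + l + m) z), ← Real.exp_add, ← Real.exp_add]
    exact Real.exp_le_exp.2 (by linarith)
  calc _ = ENNReal.ofReal
        (Real.exp (E - 2 * K) * ν.real (cyl X n x) * ν.real (cyl X m y)) := by
        rw [ENNReal.ofReal_mul (by positivity), ENNReal.ofReal_mul (by positivity),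
          ofReal_measureReal, ofReal_measureReal]
    _ ≤ ν (cyl X (n + l + m) z) := by
        rw [← ofReal_measureReal (μ := ν)]
        exact ENNReal.ofReal_le_ofReal h4
    _ ≤ ν (cyl X n x ∩ (sigma X)^[n + l] ⁻¹' cyl X m y) := measure_mono hsub
    _ ≤ _ := Finset.single_le_sum
        (f := fun l => ν (cyl X n x ∩ (sigma X)^[n + l] ⁻¹' cyl X m y))
        (fun _ _ => zero_le) (Finset.mem_range.2 (by omega))

/-- An invariant measure that is quasi-Bernoulli on a subshift with weak specification is
ergodic. -/
theorem ergodic_of_quasiBernoulli (hν : ν ∈ invMeasures X) (hX : WeakSpecification X)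
    (hpos : ∀ n x, 0 < ν.real (cyl X n x)) {K : ℝ}
    (hK : ∀ n m x, Real.log (ν.real (cyl X n x)) + Real.log (ν.real (cyl X m ((sigma X)^[n] x))) - K
      ≤ Real.log (ν.real (cyl X (n + m) x))) : Ergodic (sigma X) ν := by
  have := hν.1
  have hT := hν.2
  obtain ⟨c, hc0, p, hmix⟩ := exists_gap_mixing hX hpos hK
  refine ⟨hT, ⟨fun A hA hinv => ?_⟩⟩
  have hiter : ∀ n, (sigma X)^[n] ⁻¹' A = A := fun n => by
    rw [Set.preimage_iterate_eq]
    exact Function.iterate_fixed hinv n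
  -- Pass from cylinders to `A` in the second slot, where invariance makes all p + 1 terms equal.
  -- Extending the first slot likewise and testing on `Aᶜ` gives c ν(A) ν(Aᶜ) = 0.
  have h1 : ∀ n x, c * ν (cyl X n x) * ν A ≤ (p + 1 : ℕ) * ν (cyl X n x ∩ A) := by
    intro n x
    have hfin : IsFiniteMeasure
        (∑ l ∈ Finset.range (p + 1), (ν.restrict (cyl X n x)).map (sigma X)^[n + l]) :=
      inferInstance
    have hle : (c * ν (cyl X n x)) • ν ≤
        ∑ l ∈ Finset.range (p + 1), (ν.restrict (cyl X n x)).map (sigma X)^[n + l] := by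
      refine measure_le_of_cyl_le X fun m _ y => ?_
      rw [Measure.smul_apply, smul_eq_mul, Measure.finsetSum_apply]
      refine (hmix n m x y).trans (le_of_eq (Finset.sum_congr rfl fun l _ => ?_))
      rw [Measure.map_apply (hT.measurable.iterate _) (measurableSet_cyl X m y),
        Measure.restrict_apply' (measurableSet_cyl X n x), inter_comm]
    have h := hle A
    rw [Measure.smul_apply, smul_eq_mul, Measure.finsetSum_apply] at h
    refine h.trans (le_of_eq ?_)
    rw [Finset.sum_congr rfl fun l _ => show _ = ν (cyl X n x ∩ A) by
      rw [Measure.map_apply (hT.measurable.iterate _) hA, hiter,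
        Measure.restrict_apply' (measurableSet_cyl X n x), inter_comm]]
    simp
  have hfin : IsFiniteMeasure (((p + 1 : ℕ) : ENNReal) • ν.restrict A) :=
    (ν.restrict A).smul_finite (ENNReal.natCast_ne_top _)
  have h2 : (c * ν A) • ν ≤ ((p + 1 : ℕ) : ENNReal) • ν.restrict A := by
    refine measure_le_of_cyl_le X fun n _ x => ?_
    rw [Measure.smul_apply, Measure.smul_apply, smul_eq_mul, smul_eq_mul,
      Measure.restrict_apply' hA, mul_right_comm]
    exact h1 n x
  have h3 := h2 Aᶜ
  rw [Measure.smul_apply, Measure.smul_apply, smul_eq_mul, smul_eq_mul,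
    Measure.restrict_apply' hA, compl_inter_self, measure_empty, mul_zero, nonpos_iff_eq_zero,
    mul_eq_zero, mul_eq_zero, or_iff_right hc0] at h3
  rw [eventuallyConst_set']
  exact h3.imp ae_eq_empty.2 ae_eq_univ.2

end Ergodicity

/-! ### Consequences of the Gibbs and additivity bounds. -/

section Gibbs

variable {k : ℕ} {X : Subshift (Fin k) ℕ} {ν : Measure X.carrier} {P : ℝ}
  {f : ℕ → X.carrier → ℝ}

theorem GibbsBounds.measureReal_cyl_pos [IsProbabilityMeasure ν] (hf : IsContSeq X f) {C : ℝ}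
    (hC : 0 < C) (h : GibbsBounds X f ν P fun _ => C) (n : ℕ) (x : X.carrier) :
    0 < ν.real (cyl X n x) := by
  rcases Nat.eq_zero_or_pos n with rfl | hn
  · have : cyl X 0 x = univ := by
      ext
      simp [cyl]
    simp [this]
  · have hp := (hf n hn).2 x
    refine (measureReal_nonneg).lt_of_ne fun h0 => ?_
    have h1 := (h n hn x).1
    rw [← h0, zero_div] at h1
    exact h1.not_gt (by positivity)

theorem GibbsBounds.abs_log_le (hf : IsContSeq X f) {C : ℝ} (hC : 0 < C)
    (h : GibbsBounds X f ν P fun _ => C) (hpos : ∀ n x, 0 < ν.real (cyl X n x)) :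
    ∀ n ≥ 1, ∀ x, |Real.log (ν.real (cyl X n x)) + n * P - Real.log (f n x)| ≤ Real.log C := by
  intro n hn x
  have hp := (hf n hn).2 x
  have hν := hpos n x
  have hlog : Real.log (ν.real (cyl X n x) / (Real.exp (-(n * P)) * f n x)) =
      Real.log (ν.real (cyl X n x)) + n * P - Real.log (f n x) := by
    rw [Real.log_div hν.ne' (by positivity), Real.log_mul (by positivity) hp.ne', Real.log_exp]
    ring
  rw [← hlog, abs_le]
  constructor
  · rw [← Real.log_inv, inv_eq_one_div]
    exact Real.log_le_log (by positivity) (h n hn x).1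
  · exact Real.log_le_log (by positivity) (h n hn x).2

theorem AdditiveBounds.abs_log_le (hf : IsContSeq X f) {C : ℕ → ℝ} (h : AdditiveBounds X f C) :
    ∀ n ≥ 1, ∀ m ≥ 1, ∀ x,
      |Real.log (f (n + m) x) - Real.log (f n x) - Real.log (f m ((sigma X)^[n] x))| ≤ C n := by
  intro n hn m hm x
  have h1 := (hf n hn).2 x
  have h2 := (hf m hm).2 ((sigma X)^[n] x)
  have h3 := (hf (n + m) (by omega)).2 x
  have hu := Real.log_le_log h3 (h n hn m hm x).1
  have hl := Real.log_le_log (by positivity) (h n hn m hm x).2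
  rw [Real.log_mul (by positivity) h2.ne', Real.log_mul (by positivity) h1.ne', Real.log_exp]
    at hu hl
  rw [abs_le]
  constructor <;> linarith

/-- Only `C 1` enters, because one letter is split off; this is why weak almost additivity suffices.
`M` bounds |log f₁| by compactness. -/
theorem exists_abs_logRatio_le (hf : IsContSeq X f) (hpos : ∀ n x, 0 < ν.real (cyl X n x))
    {C : ℕ → ℝ} {D : ℝ}
    (hD : ∀ n ≥ 1, ∀ x, |Real.log (ν.real (cyl X n x)) + n * P - Real.log (f n x)| ≤ D)
    (hC : ∀ n ≥ 1, ∀ m ≥ 1, ∀ x,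
      |Real.log (f (n + m) x) - Real.log (f n x) - Real.log (f m ((sigma X)^[n] x))| ≤ C n) :
    ∃ K, ∀ n ≥ 1, ∀ x, |logRatio X ν n x + P| ≤ K := by
  have hcpt : CompactSpace X.carrier := isCompact_iff_compactSpace.1 X.isClosed.isCompact
  have hcont : Continuous fun x => Real.log (f 1 x) :=
    (hf 1 le_rfl).1.log fun x => ((hf 1 le_rfl).2 x).ne'
  obtain ⟨M, hM⟩ := isCompact_univ.exists_bound_of_continuousOn hcont.continuousOn
  refine ⟨C 1 + 2 * D + M, fun n hn x => ?_⟩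
  rw [logRatio_eq_sub hpos]
  have h1 := abs_le.1 (hD (1 + n) (by omega) x)
  have h2 := abs_le.1 (hD n hn (sigma X x))
  have h3 := abs_le.1 (hC 1 le_rfl n hn x)
  have h4 := abs_le.1 (hM x (mem_univ x))
  rw [Function.iterate_one] at h3
  rw [Nat.add_comm n 1]
  push_cast at h1
  rw [abs_le]
  constructor <;> linarith [h1.1, h1.2, h2.1, h2.2, h3.1, h3.2, h4.1, h4.2]

theorem gibbsBounds_expBirkhoff {r : X.carrier → ℝ} (hpos : ∀ n x, 0 < ν.real (cyl X n x))
    {K : ℕ → ℝ} (hK : ∀ n ≥ 1, ∀ x,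
      |birkhoffSum (sigma X) r n x - (Real.log (ν.real (cyl X n x)) + n * P)| ≤ K n) :
    GibbsBounds X (expBirkhoff X r) ν P fun n => Real.exp (K n) := by
  intro n hn x
  have h : ν.real (cyl X n x) / (Real.exp (-(n * P)) * expBirkhoff X r n x) =
      Real.exp (Real.log (ν.real (cyl X n x)) + n * P - birkhoffSum (sigma X) r n x) := by
    rw [expBirkhoff, ← Real.exp_add]
    nth_rewrite 1 [← Real.exp_log (hpos n x)]
    rw [← Real.exp_sub]
    congr 1
    ring
  have h1 := abs_le.1 (hK n hn x)
  rw [h, one_div, ← Real.exp_neg, Real.exp_le_exp, Real.exp_le_exp]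
  constructor <;> linarith [h1.1, h1.2]

/-- Length zero is included because the connecting word in specification may be empty. -/
theorem quasiBernoulli_of_bounds [IsProbabilityMeasure ν] {C D : ℝ} (hC0 : 0 ≤ C) (hD0 : 0 ≤ D)
    (hD : ∀ n ≥ 1, ∀ x, |Real.log (ν.real (cyl X n x)) + n * P - Real.log (f n x)| ≤ D)
    (hC : ∀ n ≥ 1, ∀ m ≥ 1, ∀ x,
      |Real.log (f (n + m) x) - Real.log (f n x) - Real.log (f m ((sigma X)^[n] x))| ≤ C)
    (n m : ℕ) (x : X.carrier) :
    Real.log (ν.real (cyl X n x)) + Real.log (ν.real (cyl X m ((sigma X)^[n] x))) - (C + 3 * D) ≤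
      Real.log (ν.real (cyl X (n + m) x)) := by
  have h0 : ∀ x, Real.log (ν.real (cyl X 0 x)) = 0 := fun x => by
    have : cyl X 0 x = univ := by
      ext
      simp [cyl]
    simp [this]
  rcases Nat.eq_zero_or_pos n with rfl | hn
  · rw [h0, Nat.zero_add, Function.iterate_zero_apply]
    linarith
  rcases Nat.eq_zero_or_pos m with rfl | hm
  · rw [h0, Nat.add_zero]
    linarith
  have h1 := abs_le.1 (hD (n + m) (by omega) x)
  have h2 := abs_le.1 (hD n hn x)
  have h3 := abs_le.1 (hD m hm ((sigma X)^[n] x))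
  have h4 := abs_le.1 (hC n hn m hm x)
  push_cast at h1
  linarith [h1.1, h1.2, h2.1, h2.2, h3.1, h3.2, h4.1, h4.2]

end Gibbs

end SymbGibbs

end

theorem theorem3p5 (k : ℕ) (X : Subshift (Fin k) ℕ) (hX : SymbGibbs.WeakSpecification X)
    (f : ℕ → X.carrier → ℝ) (hf : SymbGibbs.IsContSeq X f)
    (ν : Measure X.carrier) (hν : ν ∈ SymbGibbs.invMeasures X)
    (P C₀ : ℝ) (hC₀ : 0 < C₀) (hGibbs : SymbGibbs.GibbsBounds X f ν P (fun _ => C₀))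
    (hr : ∀ x, SymbGibbs.rLower X ν P x = SymbGibbs.rUpper X ν P x) :
    (SymbGibbs.AlmostAdditive X f →
      ∃ r : X.carrier → ℝ, SymbGibbs.IsLimitPotential X ν P r ∧
        (∃ K : ℝ, ∀ x, |r x| ≤ K) ∧ Measurable r ∧
        SymbGibbs.IntegralLimits X f ν P r ∧
        (SymbGibbs.IsEquilibriumSeq X f ν ∧
          ∀ μ, SymbGibbs.IsEquilibriumSeq X f μ → μ = ν) ∧
        (SymbGibbs.IsEquilibriumFun X r ν ∧
          ∀ μ, SymbGibbs.IsEquilibriumFun X r μ → μ = ν) ∧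
        (SymbGibbs.IsGibbs X (SymbGibbs.expBirkhoff X r) ν ∧
          ∀ μ, SymbGibbs.IsGibbs X (SymbGibbs.expBirkhoff X r) μ → μ = ν)) ∧
    (SymbGibbs.WeaklyAlmostAdditive X f →
      ∃ r : X.carrier → ℝ, SymbGibbs.IsLimitPotential X ν P r ∧
        (∃ K : ℝ, ∀ x, |r x| ≤ K) ∧ Measurable r ∧
        SymbGibbs.IntegralLimits X f ν P r ∧
        SymbGibbs.IsEquilibriumFun X r ν ∧
        SymbGibbs.IsWeakGibbs X (SymbGibbs.expBirkhoff X r) ν) := by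
  have := hν.1
  have hpos := hGibbs.measureReal_cyl_pos hf hC₀
  have hD := hGibbs.abs_log_le hf hC₀ hpos
  constructor
  · rintro ⟨C, hC0, hadd⟩
    have hC := hadd.abs_log_le hf
    obtain ⟨K, hK⟩ := SymbGibbs.exists_abs_logRatio_le hf hpos hD hC
    obtain ⟨r, hlim⟩ := SymbGibbs.exists_isLimitPotential hr hK
    have hint := hlim.integralLimits hpos hK hf hD
    have hS := fun (n : ℕ) (hn : n ≥ 1) x => hlim.abs_birkhoffSum_sub_le hpos hD hC hn x
    have hD0 : 0 ≤ Real.log C₀ := by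
      obtain ⟨x⟩ := nonempty_of_isProbabilityMeasure ν
      exact (abs_nonneg _).trans (hD 1 le_rfl x)
    have herg := SymbGibbs.ergodic_of_quasiBernoulli hν hX hpos
      (SymbGibbs.quasiBernoulli_of_bounds hC0.le hD0 hD hC)
    have hequi := hlim.isEquilibriumFun hν hpos hK
    have hG := SymbGibbs.gibbsBounds_expBirkhoff hpos hS
    -- Ergodicity reduces every uniqueness claim to absolute continuity.
    have heq : ∀ μ ∈ SymbGibbs.invMeasures X, μ ≪ ν → μ = ν := fun μ hμ hac =>
      have := hμ.1
      herg.eq_of_absolutelyContinuous hμ.2 hac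
    have huniq : ∀ μ, SymbGibbs.IsEquilibriumFun X r μ → μ = ν := fun μ hμ =>
      heq μ hμ.1 (SymbGibbs.absolutelyContinuous_of_isEquilibriumFun hlim hν hpos hK hS hμ)
    refine ⟨r, hlim, ⟨K, hlim.abs_apply_le hK⟩, hlim.measurable, hint,
      ⟨(SymbGibbs.isEquilibriumSeq_iff hint ν).2 hequi, fun μ hμ =>
        huniq μ ((SymbGibbs.isEquilibriumSeq_iff hint μ).1 hμ)⟩, ⟨hequi, huniq⟩,
      ⟨hν, P, _, Real.exp_pos _, hG⟩, ?_⟩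
    rintro μ ⟨hμ, P', C', hC', hG'⟩
    have := hμ.1
    exact heq μ hμ (hG'.absolutelyContinuous (fun _ _ _ => Real.exp_pos _) (Real.exp_pos _) hC' hG)
  · rintro ⟨C, -, hClim, hadd⟩
    have hC := hadd.abs_log_le hf
    obtain ⟨K, hK⟩ := SymbGibbs.exists_abs_logRatio_le hf hpos hD hC
    obtain ⟨r, hlim⟩ := SymbGibbs.exists_isLimitPotential hr hK
    refine ⟨r, hlim, ⟨K, hlim.abs_apply_le hK⟩, hlim.measurable,
      hlim.integralLimits hpos hK hf hD, hlim.isEquilibriumFun hν hpos hK, hν, P, _,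
      fun _ _ => Real.exp_pos _, ?_, SymbGibbs.gibbsBounds_expBirkhoff hpos
        fun (n : ℕ) (hn : n ≥ 1) x => hlim.abs_birkhoffSum_sub_le hpos hD hC hn x⟩
    simp only [Real.log_exp, add_div]
    simpa using hClim.add (tendsto_const_div_atTop_nhds_zero_nat (3 * Real.log C₀))
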